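/- Let $n\ge 3$, and let $\sigma_x=\begin{pmatrix}0&1\\1&0\end{pmatrix}$, $\sigma_y=\begin{pmatrix}0&i\\-i&0\end{pmatrix}$, $\sigma_z=\begin{pmatrix}1&0\\0&-1\end{pmatrix}$. Write $\sigma^j$ for the operator on $(\mathbb C^2)^{\otimes n}$ acting as $\sigma$ on the $j$-th factor and as the identity on the others. Let $H_0=\sum_{j=1}^{n-1}\sigma_z^j\sigma_z^{j+1}+\sigma_z^n\sigma_z^1$ and $H_1=\sum_{j=1}^n\sigma_x^j$, and let $\mathcal L$ (the dynamical Lie algebra) be the real Lie algebra generated by $iH_0$ and $iH_1$. For an operator $A$ put $\mathcal C(A)=\sum_{P\in C_n}PAP^{T}$, where $C_n$ is the cyclic group of order $n$ permuting the tensor factors by translations. For $0\le j\le n-2$ put $$\mathbf Y^j=i\,\mathcal C(\sigma_y\otimes\sigma_x^{\otimes j}\otimes\sigma_y\otimes\mathbf 1^{\otimes n-j-2}),\qquad \mathbf Z^j=i\,\mathcal C(\sigma_z\otimes\sigma_x^{\otimes j}\otimes\sigma_z\otimes\mathbf 1^{\otimes n-j-2}),$$ $$\mathbf{YZ}^j=i\,\mathcal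 C(\sigma_z\otimes\sigma_x^{\otimes j}\otimes\sigma_y\otimes\mathbf 1^{\otimes n-j-2})+i\,\mathcal C(\sigma_y\otimes\sigma_x^{\otimes j}\otimes\sigma_z\otimes\mathbf 1^{\otimes n-j-2}),$$ and $\mathbf X=i\,\mathcal C(\sigma_x\otimes\mathbf 1^{\otimes n-1})$, $\mathbf{XX}=i\,\mathcal C(\sigma_x^{\otimes n-1}\otimes\mathbf 1)$. Define real polynomials by $a_{-1}=0$, $a_0=1$, $a_k(\lambda)=\lambda a_{k-1}(\lambda)-a_{k-2}(\lambda)$ for $k\ge1$, and let $A_{n-1}$ be the $(n-1)\times(n-1)$ tridiagonal matrix with ones directly above and below the diagonal and zeros elsewhere. For real $\lambda$, with $a_k=a_k(\lambda)$, put $$\hat X_\lambda=a_0(\mathbf X+\mathbf Z^1)+a_{n-2}(\mathbf{XX}-\mathbf Y^{n-3})+\sum_{k=1}^{n-3}a_k(\mathbf Z^{k+1}-\mathbf Y^{k-1}),$$ $$\hat Y_\lambda=\sum_{k=0}^{n-2}a_k(\mathbf Y^k-\mathbf Z^k),\qquad \hat Z_\lambda=\sum_{k=0}^{n-2}a_k\mathbf{YZ}^k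 .$$ With $\tilde S_x=\hat X_\lambda+\hat Y_\lambda$, $\tilde S_y=\hat X_\lambda-\hat Y_\lambda$ and $\|A\|^2=\frac{1}{n2^n}\operatorname{Tr}(AA^\dagger)$, put also, for $\lambda$ a root of $a_{n-1}$, $$S_x=-\frac{\tilde S_x}{2\sqrt{2-\lambda}\,\|\tilde S_x\|\,\|\tilde S_y\|},\qquad S_y=\frac{\tilde S_y}{2\sqrt{2-\lambda}\,\|\tilde S_y\|^2},\qquad S_z=\frac{\hat Z_\lambda}{2\|\tilde S_x\|\,\|\tilde S_y\|}.$$ Then: (1) $a_{n-1}$ has exactly $n-1$ distinct real roots; they are precisely the eigenvalues of $A_{n-1}$, and each satisfies $|\lambda|<2$. (2) For every real root $\lambda$ of $a_{n-1}$, the real span $\mathcal I_\lambda$ of $\hat X_\lambda,\hat Y_\lambda,\hat Z_\lambda$, which is also the real span of $S_x,S_y,S_z$, is an ideal of $\mathcal L$; it is a simple Lie algebra and is isomorphic to $su(2)$ (the real Lie algebra of traceless skew-Hermitian $2\times2$ matrices). (3) If $\lambda_1\ne\lambda_2$ are real roots of $a_{n-1}$, then $\mathcal I_{\lambda_1}\ne\mathcal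 I_{\lambda_2}$ and $\mathcal I_{\lambda_1}\cap\mathcal I_{\lambda_2}=\{0\}$. (4) Consequently the family $\{\mathcal I_\lambda : a_{n-1}(\lambda)=0\}$ consists of $n-1$ different simple ideals of $\mathcal L$, one for each root of $a_{n-1}$. -/

import Mathlib

-- Matrices carry the commutator bracket `⁅A, B⁆ = A * B - B * A`.
attribute [local instance 100] LieRing.ofAssociativeRing

noncomputable section

namespace IsingChain

/-! ### Pauli matrices and operators on `n` spins -/

/-- The Pauli matrix `σ_x`. -/
def sigmaX : Matrix (Fin 2) (Fin 2) ℂ := !![0, 1; 1, 0]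

/-- The Pauli matrix `σ_y`, with the sign convention for which
`[iσ_x, iσ_y] = 2iσ_z` (and cyclically). -/
def sigmaY : Matrix (Fin 2) (Fin 2) ℂ := !![0, Complex.I; -Complex.I, 0]

/-- The Pauli matrix `σ_z`. -/
def sigmaZ : Matrix (Fin 2) (Fin 2) ℂ := !![1, 0; 0, -1]

/-- Operators on `(ℂ²)^{⊗ n}` (dimension `2 ^ n`), as matrices in the standard product basis,
which is indexed by the words `s : Fin n → Fin 2`. -/
abbrev Op (n : ℕ) : Type := Matrix (Fin n → Fin 2) (Fin n → Fin 2) ℂ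

/-- The tensor (Kronecker) product `M 0 ⊗ M 1 ⊗ ⋯ ⊗ M (n - 1)`. -/
def tensor {n : ℕ} (M : Fin n → Matrix (Fin 2) (Fin 2) ℂ) : Op n :=
  Matrix.of fun s t => ∏ j, M j (s j) (t j)

/-- `σ^j`: the tensor product of identities, except for `σ` at the site `j`. -/
def site {n : ℕ} (σ : Matrix (Fin 2) (Fin 2) ℂ) (j : Fin n) : Op n :=
  tensor (Function.update (fun _ => 1) j σ)

/-! ### The Hamiltonians and the dynamical Lie algebra -/

/-- The periodic Ising interaction `∑ⱼ σ_z^j σ_z^{j+1}`, where `j + 1` is taken modulo `n`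
(`finRotate n` is the cyclic successor on `Fin n`). -/
def H0 (n : ℕ) : Op n := ∑ j : Fin n, site sigmaZ j * site sigmaZ (finRotate n j)

/-- The transverse field `∑ⱼ σ_x^j`. -/
def H1 (n : ℕ) : Op n := ∑ j : Fin n, site sigmaX j

/-- The dynamical Lie algebra: the real Lie algebra generated by `i H₀` and `i H₁`. -/
def dynamicalLieAlgebra (n : ℕ) : LieSubalgebra ℝ (Op n) :=
  LieSubalgebra.lieSpan ℝ (Op n) {Complex.I • H0 n, Complex.I • H1 n}

/-- `su(m)`: the real Lie algebra of traceless skew-Hermitian `m × m` matrices. -/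
def su (m : ℕ) : LieSubalgebra ℝ (Matrix (Fin m) (Fin m) ℂ) where
  carrier := {A | A.conjTranspose = -A ∧ A.trace = 0}
  zero_mem' := by simp
  add_mem' := by
    rintro A B ⟨hA, hA'⟩ ⟨hB, hB'⟩
    refine ⟨?_, by simp [Matrix.trace_add, hA', hB']⟩
    rw [Matrix.conjTranspose_add, hA, hB, neg_add]
  smul_mem' := by
    rintro c A ⟨hA, hA'⟩
    refine ⟨?_, by simp [Matrix.trace_smul, hA']⟩
    rw [Matrix.conjTranspose_smul, hA, star_trivial, smul_neg]
  lie_mem' := by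
    rintro A B ⟨hA, _⟩ ⟨hB, _⟩
    constructor
    · simp only [Ring.lie_def, Matrix.conjTranspose_sub, Matrix.conjTranspose_mul, hA, hB]
      noncomm_ring
    · rw [Ring.lie_def, Matrix.trace_sub, Matrix.trace_mul_comm, sub_self]

/-! ### Symmetrized operators -/

/-- The unitary that permutes the `n` tensor factors by the `k`-th power of the cyclic
translation. -/
def translation (n k : ℕ) : Op n :=
  Equiv.Perm.permMatrix ℂ (Equiv.arrowCongr (finRotate n ^ k) (Equiv.refl (Fin 2)))

/-- The symmetrization `𝒞(A) = ∑_{P ∈ C_n} P A Pᵀ` over the cyclic group of order `n`. -/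
def symmetrize {n : ℕ} (A : Op n) : Op n :=
  ∑ k ∈ Finset.range n, translation n k * A * (translation n k).transpose

/-- `A ⊗ σ_x^{⊗ j} ⊗ B ⊗ 1^{⊗ (n - j - 2)}` (used for `j ≤ n - 2`). -/
def pauliString (n : ℕ) (A B : Matrix (Fin 2) (Fin 2) ℂ) (j : ℕ) : Op n :=
  tensor fun k : Fin n =>
    if (k : ℕ) = 0 then A
    else if (k : ℕ) ≤ j then sigmaX
    else if (k : ℕ) = j + 1 then B
    else 1

/-- `𝐘^j = i 𝒞(σ_y ⊗ σ_x^{⊗ j} ⊗ σ_y ⊗ 1 ⊗ ⋯ ⊗ 1)`. -/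
def bY (n j : ℕ) : Op n := Complex.I • symmetrize (pauliString n sigmaY sigmaY j)

/-- `𝐙^j = i 𝒞(σ_z ⊗ σ_x^{⊗ j} ⊗ σ_z ⊗ 1 ⊗ ⋯ ⊗ 1)`. -/
def bZ (n j : ℕ) : Op n := Complex.I • symmetrize (pauliString n sigmaZ sigmaZ j)

/-- `𝐘𝐙^j = i 𝒞(σ_z ⊗ σ_x^{⊗ j} ⊗ σ_y ⊗ 1 ⊗ ⋯) + i 𝒞(σ_y ⊗ σ_x^{⊗ j} ⊗ σ_z ⊗ 1 ⊗ ⋯)`. -/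
def bYZ (n j : ℕ) : Op n :=
  Complex.I • symmetrize (pauliString n sigmaZ sigmaY j)
    + Complex.I • symmetrize (pauliString n sigmaY sigmaZ j)

/-- `𝐗 = i 𝒞(σ_x ⊗ 1^{⊗ (n - 1)})`. -/
def bX (n : ℕ) : Op n :=
  Complex.I • symmetrize (tensor fun k : Fin n => if (k : ℕ) = 0 then sigmaX else 1)

/-- `𝐗𝐗 = i 𝒞(σ_x^{⊗ (n - 1)} ⊗ 1)`. -/
def bXX (n : ℕ) : Op n :=
  Complex.I • symmetrize (tensor fun k : Fin n => if (k : ℕ) < n - 1 then sigmaX else 1)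

/-! ### The polynomials `a_k` and the matrices `A_k` -/

/-- The polynomials `a_k`: `a_{-1} = 0`, `a_0 = 1`, `a_k = λ a_{k-1} - a_{k-2}` for `k ≥ 1`
(so `a_1 = λ`). -/
def a : ℕ → Polynomial ℝ
  | 0 => 1
  | 1 => Polynomial.X
  | k + 2 => Polynomial.X * a (k + 1) - a k

/-- The tridiagonal `k × k` matrix with ones just above and just below the diagonal and zeros
elsewhere. -/
def tridiag (k : ℕ) : Matrix (Fin k) (Fin k) ℝ :=
  Matrix.of fun i j => if (i : ℕ) + 1 = j ∨ (j : ℕ) + 1 = i then 1 else 0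

/-! ### The elements spanning the ideal of a root `x` -/

/-- `X̂ = a₀ (𝐗 + 𝐙¹) + a_{n-2} (𝐗𝐗 - 𝐘^{n-3}) + ∑_{k=1}^{n-3} a_k (𝐙^{k+1} - 𝐘^{k-1})`. -/
def hatX (n : ℕ) (x : ℝ) : Op n :=
  (a 0).eval x • (bX n + bZ n 1) + (a (n - 2)).eval x • (bXX n - bY n (n - 3))
    + ∑ k ∈ Finset.Icc 1 (n - 3), (a k).eval x • (bZ n (k + 1) - bY n (k - 1))

/-- `Ŷ = ∑_{k=0}^{n-2} a_k (𝐘^k - 𝐙^k)`. -/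
def hatY (n : ℕ) (x : ℝ) : Op n :=
  ∑ k ∈ Finset.range (n - 1), (a k).eval x • (bY n k - bZ n k)

/-- `Ẑ = ∑_{k=0}^{n-2} a_k 𝐘𝐙^k`. -/
def hatZ (n : ℕ) (x : ℝ) : Op n :=
  ∑ k ∈ Finset.range (n - 1), (a k).eval x • bYZ n k

/-- The norm of the inner product `⟨A, B⟩ = Tr(A B†) / (n 2ⁿ)`, which is normalized such that
`𝐗`, `𝐗𝐗`, `𝐘^j` and `𝐙^j` are unit vectors. -/
def opNorm {n : ℕ} (A : Op n) : ℝ :=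
  Real.sqrt ((A * A.conjTranspose).trace.re / ((n : ℝ) * 2 ^ n))

/-- `S̃_x = X̂ + Ŷ`. -/
def tildeSx (n : ℕ) (x : ℝ) : Op n := hatX n x + hatY n x

/-- `S̃_y = X̂ - Ŷ`. -/
def tildeSy (n : ℕ) (x : ℝ) : Op n := hatX n x - hatY n x

/-- `S_x = - S̃_x / (2 √(2 - x) ‖S̃_x‖ ‖S̃_y‖)`. -/
def Sx (n : ℕ) (x : ℝ) : Op n :=
  (-(1 / (2 * Real.sqrt (2 - x) * opNorm (tildeSx n x) * opNorm (tildeSy n x)))) • tildeSx n x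

/-- `S_y = S̃_y / (2 √(2 - x) ‖S̃_y‖²)`. -/
def Sy (n : ℕ) (x : ℝ) : Op n :=
  (1 / (2 * Real.sqrt (2 - x) * opNorm (tildeSy n x) ^ 2)) • tildeSy n x

/-- `S_z = Ẑ / (2 ‖S̃_x‖ ‖S̃_y‖)`. -/
def Sz (n : ℕ) (x : ℝ) : Op n :=
  (1 / (2 * opNorm (tildeSx n x) * opNorm (tildeSy n x))) • hatZ n x

end IsingChain

end

/-! Interleaving the field and interaction terms, `σ_x^0`, `σ_z^0 σ_z^1`, `σ_x^1`, `σ_z^1 σ_z^2`, …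
gives a chain of involutions of period `2 * n` in which neighbours anticommute and all other pairs
in a period commute (`isChain_gen`). Up to powers of `i`, products of consecutive members are the
Pauli strings of the statement. In a bracket of a string with a generator only the terms at or next
to its two ends survive, lengthening or shortening it. With `U_k = elU n k`, `D_k = elD n k`, `G_k =
elG n k`, so that `U_0 = iH₀` and `D_0 = -iH₁`, this yields the Onsager-type relations `[D_0, U_k] =
2 G_{k+1}`, `[D_0, D_k] = -2 G_k`, `[D_0, G_{k+1}] = -4 (U_k - D_{k+1})`, `[U_0, U_k] = 2 G_k`,
`[U_0, D_k] = -2 G_{k+1}`, `[U_0, G_{k+1}] = -4 (U_{k+1} - D_k)`, truncated by `G_0 = G_n = 0`.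

Put `P = -Ŷ = ∑ a_k (U_k - D_{k+1})`, `Q = X̂ = ∑ a_k (U_{k+1} - D_k)` and `Z = Ẑ = ∑ a_k G_{k+1}`.
The recurrence of the `a_k`, with `a_{n-1}(x) = 0` and the truncation, gives `∑ a_k (G_k + G_{k+2})
= x Z` (`sum_a_smul_add`). Hence both generators preserve the span of `P`, `Q`, `Z`
(`isRootTriple`), which is therefore an ideal.

The Jacobi identity determines the brackets inside this span up to one scalar `α`
(`IsRootTriple.exists_lie_eq`). Invariance of the trace form, definite on skew-Hermitian matrices,
gives `α ≠ 0` (`lie_hatY_hatZ_ne_zero`). As `x² < 4`, rescaling `P + Q`, `P - Q`, `Z` then produces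
the relations of `su(2)`. Distinct roots are told apart by the eigenvalue `-8x` of `ad U_0 ∘ ad D_0`
on `Z`, and simplicity turns non-inclusion into trivial intersection. The roots are those of a
rescaled Chebyshev polynomial of the second kind. -/

namespace IsingChain

/-! ### Periodic chains of anticommuting involutions -/

section Chain

variable {R : Type*} [Ring R]

/-- A sequence of involutions, of period `2 * n`, in which neighbours anticommute and all the other
elements of a period commute. -/
structure IsChain (n : ℕ) (e : ℕ → R) : Prop where
  two_le : 2 ≤ n
  sq : ∀ i, e i * e i = 1
  anti : ∀ i, e i * e (i + 1) = -(e (i + 1) * e i)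
  comm : ∀ i t, 2 ≤ t → t ≤ 2 * n - 2 → Commute (e i) (e (i + t))
  period : ∀ i, e (i + 2 * n) = e i

/-- The product `e i * e (i + 1) * ⋯ * e (i + l - 1)`. -/
def word (e : ℕ → R) (i : ℕ) : ℕ → R
  | 0 => 1
  | l + 1 => word e i l * e (i + l)

/-- The sum of the words of length `l` that start at the positions `p + 2 * s`, `s < n`. -/
def wordSum (n : ℕ) (e : ℕ → R) (p l : ℕ) : R := ∑ s ∈ Finset.range n, word e (p + 2 * s) l

lemma word_succ_left (e : ℕ → R) (i l : ℕ) : word e i (l + 1) = e i * word e (i + 1) l := by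
  induction l with
  | zero => simp [word]
  | succ l ih =>
    rw [word, ih, word, mul_assoc]
    congr 3
    omega

lemma commute_word {e : ℕ → R} {x : R} {i l : ℕ} (h : ∀ s < l, Commute x (e (i + s))) :
    Commute x (word e i l) := by
  induction l with
  | zero => exact Commute.one_right x
  | succ l ih => exact (ih fun s hs => h s (by omega)).mul_right (h l (by omega))

lemma wordSum_one_eq (n : ℕ) (e : ℕ → R) (i : ℕ) :
    wordSum n e i 1 = ∑ s ∈ Finset.range n, e (i + 2 * s) := by
  simp [wordSum, word]

lemma sum_word (n : ℕ) (e : ℕ → R) (q p l : ℕ) :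
    ∑ s ∈ Finset.range n, word e (p + 2 * s + q) l = wordSum n e (p + q) l :=
  Finset.sum_congr rfl fun s _ => by congr 1; ring

/-! ### Products and commutators of words in a chain -/

namespace IsChain

variable {n : ℕ} {e : ℕ → R} (h : IsChain n e)
include h

lemma word_period (i l : ℕ) : word e (i + 2 * n) l = word e i l := by
  induction l with
  | zero => rfl
  | succ l ih => rw [word, word, ih, add_right_comm, h.period]

lemma wordSum_add_two (p l : ℕ) : wordSum n e (p + 2) l = wordSum n e p l := by
  have h1 := Finset.sum_range_succ (fun s => word e (p + 2 * s) l) n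
  have h2 := Finset.sum_range_succ' (fun s => word e (p + 2 * s) l) n
  rw [h1, h.word_period] at h2
  simp only [mul_zero, add_zero] at h2
  rw [wordSum, wordSum, add_right_cancel h2]
  exact Finset.sum_congr rfl fun s _ => by congr 1; ring

lemma wordSum_add_two_mul (p s l : ℕ) : wordSum n e (p + 2 * s) l = wordSum n e p l := by
  induction s with
  | zero => rfl
  | succ s ih => rw [← ih, ← h.wordSum_add_two (p + 2 * s), mul_add, mul_one, add_assoc]

lemma commute_outside (i : ℕ) {t l : ℕ} (h1 : l + 1 ≤ t) (h2 : t ≤ 2 * n - 2) :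
    Commute (e (i + t)) (word e i l) :=
  commute_word fun s hs => by
    have := h.comm (i + s) (t - s) (by omega) (by omega)
    rw [show i + s + (t - s) = i + t by omega] at this
    exact this.symm

lemma mul_word_right (i : ℕ) {l : ℕ} (h1 : 1 ≤ l) (h2 : l ≤ 2 * n - 2) :
    e (i + l) * word e i l = -word e i (l + 1) := by
  obtain ⟨k, rfl⟩ : ∃ k, l = k + 1 := ⟨l - 1, by omega⟩
  have hc := h.commute_outside i (l := k) (t := k + 1) le_rfl (by omega)
  have ha := h.anti (i + k)
  rw [add_assoc] at ha
  rw [word, word, word, ← mul_assoc, hc.eq, mul_assoc, mul_assoc, ha, mul_neg, neg_neg]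

lemma word_mul_left (i : ℕ) {l : ℕ} (h1 : 1 ≤ l) (h2 : l ≤ 2 * n - 2) :
    word e (i + 1) l * e i = -word e i (l + 1) := by
  obtain ⟨k, rfl⟩ : ∃ k, l = k + 1 := ⟨l - 1, by omega⟩
  have hc : Commute (e i) (word e (i + 1 + 1) k) := commute_word fun s hs => by
    rw [show i + 1 + 1 + s = i + (s + 2) by omega]
    exact h.comm i (s + 2) (by omega) (by omega)
  rw [word_succ_left, word_succ_left, word_succ_left, mul_assoc, ← hc.eq, ← mul_assoc, ← mul_assoc,
    h.anti i, neg_mul, neg_neg]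

lemma mul_word_last (i : ℕ) {l : ℕ} (h1 : 1 ≤ l) (h2 : l ≤ 2 * n - 2) :
    e (i + l) * word e i (l + 1) = -word e i l := by
  rw [word, ← mul_assoc, h.mul_word_right i h1 h2, word, neg_mul, mul_assoc, h.sq, mul_one]

lemma word_mul_last (i l : ℕ) : word e i (l + 1) * e (i + l) = word e i l := by
  rw [word, mul_assoc, h.sq, mul_one]

lemma mul_word_first (i l : ℕ) : e i * word e i (l + 1) = word e (i + 1) l := by
  rw [word_succ_left, ← mul_assoc, h.sq, one_mul]

lemma word_mul_first (i : ℕ) {l : ℕ} (h1 : 1 ≤ l) (h2 : l ≤ 2 * n - 2) :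
    word e i (l + 1) * e i = -word e (i + 1) l := by
  rw [word_succ_left, mul_assoc, h.word_mul_left i h1 h2, mul_neg, h.mul_word_first]

/-- An interior letter anticommutes with exactly its two neighbours in the word, and the two signs
cancel. -/
lemma commute_inside (i : ℕ) {t l : ℕ} (h1 : 1 ≤ t) (h2 : t + 2 ≤ l) (h3 : l ≤ 2 * n - 1) :
    Commute (e (i + t)) (word e i l) := by
  induction l, h2 using Nat.le_induction with
  | base =>
    have h4 := h.mul_word_last i h1 (by omega)
    have h5 := h.word_mul_last i t
    have h6 := h.anti (i + t)
    rw [word, Commute, SemiconjBy, ← mul_assoc, h4, mul_assoc, ← add_assoc,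
      ← neg_eq_iff_eq_neg.2 h6, mul_neg, ← mul_assoc, h5, neg_mul]
  | succ l hl ih =>
    refine (ih (by omega)).mul_right ?_
    rw [show i + l = i + t + (l - t) by omega]
    exact h.comm _ _ (by omega) (by omega)

/-- The one letter missing from the word is, cyclically, a neighbour of both its ends; again two
signs cancel. -/
lemma commute_full (i : ℕ) : Commute (e (i + (2 * n - 1))) (word e i (2 * n - 1)) := by
  have hn := h.two_le
  have h1 := h.word_mul_left (i + (2 * n - 1)) (l := 2 * n - 2) (by omega) le_rfl
  have h2 := word_succ_left e (i + (2 * n - 1)) (2 * n - 2)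
  have h3 := h.anti (i + (2 * n - 2))
  rw [show i + (2 * n - 1) + 1 = i + 2 * n by omega, h.word_period] at h1 h2
  rw [show i + (2 * n - 2) + 1 = i + (2 * n - 1) by omega] at h3
  rw [show 2 * n - 1 = 2 * n - 2 + 1 by omega] at *
  rw [Commute, SemiconjBy, word, ← mul_assoc, ← h2, mul_assoc, h3, mul_neg, ← mul_assoc, h1, neg_mul,
    neg_neg]

/-- The first letter commutes with the product of the others, so it may be moved to the end. This is
what makes `elG n n` vanish. -/
lemma word_full_succ (i : ℕ) : word e (i + 1) (2 * n) = word e i (2 * n) := by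
  have hn := h.two_le
  have h1 := h.commute_full (i + 1)
  rw [show i + 1 + (2 * n - 1) = i + 2 * n by omega, h.period] at h1
  rw [show 2 * n = 2 * n - 1 + 1 by omega, word, word_succ_left,
    show i + 1 + (2 * n - 1) = i + 2 * n by omega, h.period, h1.eq]

/-- The letters of the sum have the parity of both ends of the word. Only the two end letters fail
to commute with it, and each of them shortens it; for `m = 0` they coincide and everything commutes.
-/
lemma lie_word_odd_same (i : ℕ) {m : ℕ} (hm : m ≤ n - 1) :
    ⁅wordSum n e i 1, word e i (2 * m + 1)⁆ = 2 * word e (i + 1) (2 * m) - 2 * word e i (2 * m) := by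
  have hn := h.two_le
  rw [wordSum_one_eq, LieRing.of_associative_ring_bracket, Finset.sum_mul, Finset.mul_sum,
    ← Finset.sum_sub_distrib]
  rcases Nat.eq_zero_or_pos m with rfl | hm0
  · refine (Finset.sum_eq_zero fun s hs => sub_eq_zero.2 ?_).trans (by simp [word])
    rw [Finset.mem_range] at hs
    refine commute_word fun t ht => ?_
    obtain rfl : t = 0 := by omega
    rcases Nat.eq_zero_or_pos s with rfl | hs0
    · exact Commute.refl _
    · exact (h.comm i (2 * s) (by omega) (by omega)).symm
  · rw [Finset.sum_eq_add_of_mem 0 m (by simp; omega) (by simp; omega) (by omega)]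
    · rw [mul_zero, add_zero, h.mul_word_first, h.word_mul_first i (by omega) (by omega),
        h.mul_word_last i (by omega) (by omega), h.word_mul_last]
      noncomm_ring
    · intro s hs hs'
      rw [Finset.mem_range] at hs
      refine sub_eq_zero.2 ?_
      rcases lt_or_gt_of_ne hs'.2 with h1 | h1
      · exact h.commute_inside i (by omega) (by omega) (by omega)
      · exact h.commute_outside i (by omega) (by omega)

/-- Here the non-commuting letters are the two just outside the word, and each lengthens it. -/
lemma lie_word_odd_other (i : ℕ) {m : ℕ} (hm : m + 1 ≤ n - 1) :
    ⁅wordSum n e (i + 1) 1, word e i (2 * m + 1)⁆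
      = 2 * word e (i + 1 + 2 * (n - 1)) (2 * m + 2) - 2 * word e i (2 * m + 2) := by
  have hn := h.two_le
  rw [wordSum_one_eq, LieRing.of_associative_ring_bracket, Finset.sum_mul, Finset.mul_sum,
    ← Finset.sum_sub_distrib]
  -- By periodicity the index `s = n - 1` is the letter just before position `i`; `s = m` is the one
  -- just after the word.
  rw [Finset.sum_eq_add_of_mem (n - 1) m (by simp; omega) (by simp; omega) (by omega)]
  · have h1 := h.mul_word_right i (l := 2 * m + 1) (by omega) (by omega)
    have h2 := h.word_mul_left (i + 1 + 2 * (n - 1)) (l := 2 * m + 1) (by omega) (by omega)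
    have h3 := word_succ_left e (i + 1 + 2 * (n - 1)) (2 * m + 1)
    rw [show i + 1 + 2 * (n - 1) + 1 = i + 2 * n by omega, h.word_period] at h2 h3
    rw [← add_assoc, add_right_comm] at h1
    have h4 : word e i (2 * m + 1) * e (i + 1 + 2 * m) = word e i (2 * m + 1 + 1) := by
      rw [word.eq_2 e i (2 * m + 1), ← add_assoc, add_right_comm]
    rw [← h3, h2, h1, h4]
    noncomm_ring
  · intro s hs hs'
    rw [Finset.mem_range] at hs
    refine sub_eq_zero.2 ?_
    rw [show i + 1 + 2 * s = i + (2 * s + 1) by ring]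
    rcases lt_or_gt_of_ne hs'.2 with h1 | h1
    · exact h.commute_inside i (by omega) (by omega) (by omega)
    · exact h.commute_outside i (by omega) (by omega)

lemma lie_word_full (i : ℕ) : ⁅wordSum n e (i + 1) 1, word e i (2 * n - 1)⁆ = 0 := by
  have hn := h.two_le
  rw [wordSum_one_eq, LieRing.of_associative_ring_bracket, Finset.sum_mul, Finset.mul_sum,
    ← Finset.sum_sub_distrib]
  refine Finset.sum_eq_zero fun s hs => sub_eq_zero.2 ?_
  rw [Finset.mem_range] at hs
  rw [show i + 1 + 2 * s = i + (2 * s + 1) by ring]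
  by_cases h1 : s = n - 1
  · rw [h1, show 2 * (n - 1) + 1 = 2 * n - 1 by omega]
    exact h.commute_full i
  · exact h.commute_inside i (by omega) (by omega) (by omega)

/-- In a word of even length the ends have opposite parities: the first letter shortens it and the
letter after its end lengthens it. `lie_word_even_other` is the mirror image. -/
lemma lie_word_even_same (i : ℕ) {m : ℕ} (hm : m + 1 ≤ n - 1) :
    ⁅wordSum n e i 1, word e i (2 * m + 2)⁆
      = 2 * word e (i + 1) (2 * m + 1) - 2 * word e i (2 * m + 3) := by
  have hn := h.two_le
  rw [wordSum_one_eq, LieRing.of_associative_ring_bracket, Finset.sum_mul, Finset.mul_sum,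
    ← Finset.sum_sub_distrib]
  rw [Finset.sum_eq_add_of_mem 0 (m + 1) (by simp; omega) (by simp; omega) (by omega)]
  · have h1 : word e i (2 * m + 2) * e (i + 2 * (m + 1)) = word e i (2 * m + 3) := rfl
    have h2 := h.mul_word_right i (l := 2 * m + 2) (by omega) (by omega)
    rw [mul_zero, add_zero, h.mul_word_first, h.word_mul_first i (by omega) (by omega), h1,
      show i + 2 * (m + 1) = i + (2 * m + 2) by ring, h2]
    noncomm_ring
  · intro s hs hs'
    rw [Finset.mem_range] at hs
    refine sub_eq_zero.2 ?_
    rcases lt_or_gt_of_ne hs'.2 with h1 | h1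
    · exact h.commute_inside i (by omega) (by omega) (by omega)
    · exact h.commute_outside i (by omega) (by omega)

lemma lie_word_even_other (i : ℕ) {m : ℕ} (hm : m + 1 ≤ n - 1) :
    ⁅wordSum n e (i + 1) 1, word e i (2 * m + 2)⁆
      = 2 * word e (i + 1 + 2 * (n - 1)) (2 * m + 3) - 2 * word e i (2 * m + 1) := by
  have hn := h.two_le
  rw [wordSum_one_eq, LieRing.of_associative_ring_bracket, Finset.sum_mul, Finset.mul_sum,
    ← Finset.sum_sub_distrib]
  rw [Finset.sum_eq_add_of_mem (n - 1) m (by simp; omega) (by simp; omega) (by omega)]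
  · have h1 := h.mul_word_last i (l := 2 * m + 1) (by omega) (by omega)
    have h2 := h.word_mul_left (i + 1 + 2 * (n - 1)) (l := 2 * m + 2) (by omega) (by omega)
    have h3 := word_succ_left e (i + 1 + 2 * (n - 1)) (2 * m + 2)
    have h4 := h.word_mul_last i (2 * m + 1)
    rw [show i + 1 + 2 * (n - 1) + 1 = i + 2 * n by omega, h.word_period] at h2 h3
    rw [show i + 1 + 2 * m = i + (2 * m + 1) by ring, ← h3, h2, h1, h4]
    noncomm_ring
  · intro s hs hs'
    rw [Finset.mem_range] at hs
    refine sub_eq_zero.2 ?_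
    rw [show i + 1 + 2 * s = i + (2 * s + 1) by ring]
    rcases lt_or_gt_of_ne hs'.2 with h1 | h1
    · exact h.commute_inside i (by omega) (by omega) (by omega)
    · exact h.commute_outside i (by omega) (by omega)

/-- A sum of letters is unchanged by a shift of its base point by an even number, so each bracket
can be taken with the base point at the start of its own word. -/
lemma lie_wordSum_eq (q p l : ℕ) :
    ⁅wordSum n e (p + q) 1, wordSum n e p l⁆
      = ∑ s ∈ Finset.range n, ⁅wordSum n e (p + 2 * s + q) 1, word e (p + 2 * s) l⁆ := by
  rw [wordSum.eq_1 n e p l, lie_sum]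
  exact Finset.sum_congr rfl fun s _ => by rw [add_right_comm, h.wordSum_add_two_mul]

lemma lie_wordSum_odd_same (p : ℕ) {m : ℕ} (hm : m ≤ n - 1) :
    ⁅wordSum n e p 1, wordSum n e p (2 * m + 1)⁆
      = 2 * wordSum n e (p + 1) (2 * m) - 2 * wordSum n e p (2 * m) := by
  have := h.lie_wordSum_eq 0 p (2 * m + 1)
  simp only [add_zero] at this
  rw [this, Finset.sum_congr rfl fun s _ => h.lie_word_odd_same (p + 2 * s) hm,
    Finset.sum_sub_distrib, ← Finset.mul_sum, ← Finset.mul_sum, sum_word, ← wordSum]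

lemma lie_wordSum_odd_other (p : ℕ) {m : ℕ} (hm : m ≤ n - 1) :
    ⁅wordSum n e (p + 1) 1, wordSum n e p (2 * m + 1)⁆
      = 2 * wordSum n e (p + 1) (2 * m + 2) - 2 * wordSum n e p (2 * m + 2) := by
  rw [h.lie_wordSum_eq]
  rcases hm.lt_or_eq with hm | rfl
  · rw [Finset.sum_congr rfl fun s _ => h.lie_word_odd_other (p + 2 * s) hm,
      Finset.sum_sub_distrib, ← Finset.mul_sum, ← Finset.mul_sum, ← wordSum]
    simp only [add_assoc (p + 2 * _)]
    rw [sum_word, ← add_assoc, h.wordSum_add_two_mul]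
  -- For `m = n - 1` the two lengthening letters coincide: the bracket vanishes, and so does the
  -- right side, as full words do not depend on their starting point.
  · have hn := h.two_le
    rw [show 2 * (n - 1) + 1 = 2 * n - 1 by omega, show 2 * (n - 1) + 2 = 2 * n by omega,
      Finset.sum_eq_zero fun s _ => h.lie_word_full (p + 2 * s), ← sum_word n e 1 p, wordSum]
    simp [h.word_full_succ]

lemma lie_wordSum_even_same (p : ℕ) {m : ℕ} (hm : m + 1 ≤ n - 1) :
    ⁅wordSum n e p 1, wordSum n e p (2 * m + 2)⁆
      = 2 * wordSum n e (p + 1) (2 * m + 1) - 2 * wordSum n e p (2 * m + 3) := by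
  have := h.lie_wordSum_eq 0 p (2 * m + 2)
  simp only [add_zero] at this
  rw [this, Finset.sum_congr rfl fun s _ => h.lie_word_even_same (p + 2 * s) hm,
    Finset.sum_sub_distrib, ← Finset.mul_sum, ← Finset.mul_sum, sum_word, ← wordSum]

lemma lie_wordSum_even_other (p : ℕ) {m : ℕ} (hm : m + 1 ≤ n - 1) :
    ⁅wordSum n e (p + 1) 1, wordSum n e p (2 * m + 2)⁆
      = 2 * wordSum n e (p + 1) (2 * m + 3) - 2 * wordSum n e p (2 * m + 1) := by
  rw [h.lie_wordSum_eq, Finset.sum_congr rfl fun s _ => h.lie_word_even_other (p + 2 * s) hm,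
    Finset.sum_sub_distrib, ← Finset.mul_sum, ← Finset.mul_sum, ← wordSum]
  simp only [add_assoc (p + 2 * _)]
  rw [sum_word, ← add_assoc, h.wordSum_add_two_mul]

end IsChain

end Chain

/-! ### The polynomials `a k` -/

lemma a_eval_add_two (k : ℕ) (x : ℝ) :
    (a (k + 2)).eval x = x * (a (k + 1)).eval x - (a k).eval x := by
  simp [a]

lemma a_eq_S (k : ℕ) : a k = Polynomial.Chebyshev.S ℝ k := by
  induction k using a.induct with
  | case1 => simp [a]
  | case2 => simp [a]
  | case3 k h1 h2 =>
    rw [a, h1, h2]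
    exact (Polynomial.Chebyshev.S_add_two ℝ k).symm

/-- `a m` at `x` is the Chebyshev polynomial `U m` at `x / 2`, whose zeros are `cos ((k + 1) π / (m
+ 1))`. -/
lemma isRoot_a_iff (m : ℕ) (x : ℝ) :
    (a m).IsRoot x ↔
      x ∈ (Finset.range m).image fun k : ℕ => 2 * Real.cos ((k + 1) * Real.pi / (m + 1)) := by
  have h1 : (a m).eval x = (Polynomial.Chebyshev.U ℝ m).eval (x / 2) := by
    rw [← Polynomial.Chebyshev.S_comp_two_mul_X, a_eq_S, Polynomial.eval_comp]
    congr 1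
    simp
    ring
  have h2 : Polynomial.Chebyshev.U ℝ m ≠ 0 := fun h => by
    have := Polynomial.Chebyshev.degree_U_natCast (R := ℝ) m
    rw [h] at this
    simp at this
  rw [Polynomial.IsRoot, h1, ← Polynomial.IsRoot, ← Polynomial.mem_roots h2,
    Polynomial.Chebyshev.roots_U_real, Finset.mem_val, Finset.mem_image, Finset.mem_image]
  refine exists_congr fun k => and_congr_right fun _ => ?_
  rw [eq_div_iff two_ne_zero, mul_comm]

lemma ncard_roots_a (m : ℕ) : {x : ℝ | (a m).IsRoot x}.ncard = m := by
  have h1 : {x : ℝ | (a m).IsRoot x} = ((Finset.range m).image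
      fun k : ℕ => 2 * Real.cos ((k + 1) * Real.pi / (m + 1)) : Finset ℝ) := by
    ext x
    rw [Set.mem_ofPred_eq, isRoot_a_iff, Finset.mem_coe]
  rw [h1, Set.ncard_coe_finset, Finset.card_image_of_injOn, Finset.card_range]
  have h2 := (Finset.range m).nodup_map_iff_injOn.mp (Polynomial.Chebyshev.roots_U_real_nodup m)
  exact fun i hi j hj hij => h2 hi hj (mul_left_cancel₀ two_ne_zero hij)

lemma abs_lt_two_of_isRoot_a {m : ℕ} {x : ℝ} (hx : (a m).IsRoot x) : |x| < 2 := by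
  rw [isRoot_a_iff, Finset.mem_image] at hx
  obtain ⟨k, hk, rfl⟩ := hx
  rw [Finset.mem_range] at hk
  have hk' : (k : ℝ) + 1 < m + 1 := by exact_mod_cast Nat.succ_lt_succ hk
  have h0 : 0 < (k + 1) * Real.pi / (m + 1) := by positivity
  have h1 : (k + 1) * Real.pi / (m + 1) < Real.pi := by
    rw [div_lt_iff₀ (by positivity), mul_comm Real.pi]
    exact mul_lt_mul_of_pos_right hk' Real.pi_pos
  have hs := Real.sin_pos_of_pos_of_lt_pi h0 h1
  have hc := Real.sin_sq_add_cos_sq ((k + 1) * Real.pi / (m + 1))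
  rw [abs_lt]
  constructor <;> nlinarith

/-- The eigenvalue equation of `tridiag m`, written for a vector extended by zero. -/
lemma tridiag_mulVec {m : ℕ} (v : ℕ → ℝ) (hv : v m = 0) (i : Fin m) :
    (tridiag m).mulVec (fun j => v j) i = v (i + 1) + if (i : ℕ) = 0 then 0 else v (i - 1) := by
  rw [Matrix.mulVec, dotProduct]
  simp only [tridiag, Matrix.of_apply, ite_mul, one_mul, zero_mul]
  rw [Fin.sum_univ_eq_sum_range
    (fun j => if (i : ℕ) + 1 = j ∨ j + 1 = (i : ℕ) then v j else 0) m]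
  -- For `i = 0` the truncated `i - 1` equals `0`, so the lower neighbour needs the inner guard.
  have h1 : ∀ j ∈ Finset.range m, (if (i : ℕ) + 1 = j ∨ j + 1 = (i : ℕ) then v j else 0)
      = (if j = (i : ℕ) + 1 then v j else 0)
        + if j = (i : ℕ) - 1 then (if (i : ℕ) = 0 then 0 else v j) else 0 := by
    intro j _
    split_ifs <;> first | omega | simp
  rw [Finset.sum_congr rfl h1, Finset.sum_add_distrib, Finset.sum_ite_eq', Finset.sum_ite_eq']
  have hi := i.2
  rw [if_pos (Finset.mem_range.2 (by omega : (i : ℕ) - 1 < m))]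
  congr 1
  split_ifs with h2
  · rfl
  · rw [Finset.mem_range] at h2
    rw [show (i : ℕ) + 1 = m by omega, hv]

/-- The vector `(a_0(x), …, a_{m-1}(x))` satisfies every row of the eigenvalue equation but the
last, which says `a_m(x) = 0`. Conversely the rows force any eigenvector to be a multiple of it. -/
lemma isRoot_a_iff_hasEigenvalue {m : ℕ} (hm : 0 < m) (x : ℝ) :
    (a m).IsRoot x ↔ Module.End.HasEigenvalue (Matrix.toLin' (tridiag m)) x := by
  constructor
  · intro hx
    refine Module.End.hasEigenvalue_of_hasEigenvector (x := fun j : Fin m => (a j).eval x)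
      ⟨Module.End.mem_eigenspace_iff.2 (funext fun i => ?_), fun h => ?_⟩
    · rw [Matrix.toLin'_apply, tridiag_mulVec (fun j => (a j).eval x) hx, Pi.smul_apply, smul_eq_mul]
      obtain ⟨i, hi⟩ := i
      cases i with
      | zero => simp [a]
      | succ i => simp [a_eval_add_two]
    · have := congr_fun h ⟨0, hm⟩
      simp [a] at this
  · intro hx
    obtain ⟨v, hv⟩ := hx.exists_hasEigenvector
    set w : ℕ → ℝ := fun j => if hj : j < m then v ⟨j, hj⟩ else 0 with hw
    have hvw : v = fun j : Fin m => w j := by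
      funext j
      simp [hw]
    have hwm : w m = 0 := by simp [hw]
    have hrec : ∀ i < m, w (i + 1) + (if i = 0 then 0 else w (i - 1)) = x * w i := by
      intro i hi
      have h1 := congr_fun hv.apply_eq_smul ⟨i, hi⟩
      rw [Matrix.toLin'_apply, hvw, tridiag_mulVec w hwm] at h1
      exact h1
    have hsol : ∀ i, (i ≤ m → w i = (a i).eval x * w 0) ∧
        (i + 1 ≤ m → w (i + 1) = (a (i + 1)).eval x * w 0) := by
      intro i
      induction i with
      | zero =>
        refine ⟨fun _ => by simp [a], fun h => ?_⟩
        simpa [a] using hrec 0 (by omega)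
      | succ i ih =>
        refine ⟨ih.2, fun h => ?_⟩
        have h1 := hrec (i + 1) (by omega)
        rw [if_neg (by omega), Nat.add_sub_cancel, ih.2 (by omega), ih.1 (by omega)] at h1
        rw [a_eval_add_two]
        linear_combination h1
    have hw0 : w 0 ≠ 0 := fun h0 => hv.2 <| by
      rw [hvw]
      funext j
      rw [(hsol j).1 j.2.le, h0, mul_zero, Pi.zero_apply]
    have := (hsol m).1 le_rfl
    rw [hwm, eq_comm, mul_eq_zero] at this
    exact this.resolve_right hw0

/-- Summation by parts against the recurrence. In the application `G 0`, `G (N + 2)` and `a (N + 1)`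
at `x` are all zero, so every boundary term disappears. -/
lemma sum_a_smul_add {M : Type*} [AddCommGroup M] [Module ℝ M] (G : ℕ → M) (x : ℝ) (N : ℕ) :
    ∑ k ∈ Finset.range (N + 1), (a k).eval x • (G k + G (k + 2))
      = x • ∑ k ∈ Finset.range (N + 1), (a k).eval x • G (k + 1)
        + G 0 + (a N).eval x • G (N + 2) - (a (N + 1)).eval x • G (N + 1) := by
  induction N with
  | zero =>
    simp [a]
    abel
  | succ N ih =>
    rw [Finset.sum_range_succ, ih, Finset.sum_range_succ _ (N + 1), a_eval_add_two]
    module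

lemma span_add_sub_eq {M : Type*} [AddCommGroup M] [Module ℝ M] {r s t : ℝ} (hr : r ≠ 0)
    (hs : s ≠ 0) (ht : t ≠ 0) (P Q Z : M) :
    Submodule.span ℝ {r • (P + Q), s • (P - Q), t • Z} = Submodule.span ℝ {P, Q, Z} := by
  refine le_antisymm (Submodule.span_le.2 ?_) (Submodule.span_le.2 ?_) <;>
    rintro v (rfl | rfl | rfl) <;> rw [SetLike.mem_coe, Submodule.mem_span_triple]
  · exact ⟨r, r, 0, by module⟩
  · exact ⟨s, -s, 0, by module⟩
  · exact ⟨0, 0, t, by module⟩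
  · refine ⟨1 / (2 * r), 1 / (2 * s), 0, ?_⟩
    rw [zero_smul, add_zero]
    match_scalars <;> field_simp <;> ring
  · refine ⟨1 / (2 * r), -1 / (2 * s), 0, ?_⟩
    rw [zero_smul, add_zero]
    match_scalars <;> field_simp <;> ring
  · exact ⟨0, 0, 1 / t, by simp [smul_smul, ht]⟩

/-! ### Three-dimensional Lie algebras of type `su(2)` -/

section SuTwo

variable {𝔤 𝔥 : Type*} [LieRing 𝔤] [LieRing 𝔥]

/-- Three elements that bracket cyclically, like `i σ / 2` for the Pauli matrices `σ`. -/
structure IsCyclicTriple (s : Fin 3 → 𝔤) : Prop where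
  lie_zero_one : ⁅s 0, s 1⁆ = s 2
  lie_one_two : ⁅s 1, s 2⁆ = s 0
  lie_two_zero : ⁅s 2, s 0⁆ = s 1

namespace IsCyclicTriple

variable {s : Fin 3 → 𝔤} (hs : IsCyclicTriple s)
include hs

lemma lie_one_zero : ⁅s 1, s 0⁆ = -s 2 := by rw [← lie_skew, hs.lie_zero_one]

lemma lie_two_one : ⁅s 2, s 1⁆ = -s 0 := by rw [← lie_skew, hs.lie_one_two]

lemma lie_zero_two : ⁅s 0, s 2⁆ = -s 1 := by rw [← lie_skew, hs.lie_two_zero]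

end IsCyclicTriple

variable [LieAlgebra ℝ 𝔤] [LieAlgebra ℝ 𝔥]

lemma nonempty_lieEquiv_of_isCyclicTriple (b : Module.Basis (Fin 3) ℝ 𝔤)
    (c : Module.Basis (Fin 3) ℝ 𝔥) (hb : IsCyclicTriple b) (hc : IsCyclicTriple c) :
    Nonempty (𝔤 ≃ₗ⁅ℝ⁆ 𝔥) := by
  refine ⟨{ b.equiv c (Equiv.refl _) with map_lie' := fun {x y} => ?_ }⟩
  change b.equiv c (Equiv.refl _) ⁅x, y⁆
    = ⁅b.equiv c (Equiv.refl _) x, b.equiv c (Equiv.refl _) y⁆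
  rw [← b.sum_repr x, ← b.sum_repr y]
  simp only [Fin.sum_univ_three, lie_add, add_lie, lie_smul, smul_lie, lie_self, map_add, map_smul,
    hb.lie_zero_one, hb.lie_one_two, hb.lie_two_zero, hb.lie_one_zero, hb.lie_two_one,
    hb.lie_zero_two, map_neg, Module.Basis.equiv_apply, Equiv.refl_apply,
    hc.lie_zero_one, hc.lie_one_two, hc.lie_two_zero, hc.lie_one_zero, hc.lie_two_one,
    hc.lie_zero_two, map_zero]

/-- Suitable double brackets with basis vectors reduce an element to a single coordinate times a
basis vector. A nonzero ideal thus contains one basis vector, and the cyclic relations give the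
others. -/
lemma isSimple_of_isCyclicTriple (b : Module.Basis (Fin 3) ℝ 𝔤) (hb : IsCyclicTriple b) :
    LieAlgebra.IsSimple ℝ 𝔤 where
  non_abelian h := b.ne_zero 2 <| by rw [← hb.lie_zero_one, h.trivial]
  eq_bot_or_eq_top J := by
    refine or_iff_not_imp_left.2 fun hJ => ?_
    obtain ⟨w, hw, hw0⟩ : ∃ w ∈ J, w ≠ 0 := by
      simpa [LieSubmodule.eq_bot_iff] using hJ
    have key : ∀ c : ℝ, ∀ v, c ≠ 0 → c • v ∈ J → v ∈ J := fun c v hc hv => by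
      simpa [smul_smul, hc] using J.smul_mem c⁻¹ hv
    have hcycle : ∀ i, b i ∈ J → b 0 ∈ J ∧ b 1 ∈ J ∧ b 2 ∈ J := by
      intro i hi
      fin_cases i
      · have h1 : b 1 ∈ J := hb.lie_two_zero ▸ lie_mem_right ℝ 𝔤 J (b 2) (b 0) hi
        exact ⟨hi, h1, hb.lie_zero_one ▸ lie_mem_right ℝ 𝔤 J (b 0) (b 1) h1⟩
      · have h2 : b 2 ∈ J := hb.lie_zero_one ▸ lie_mem_right ℝ 𝔤 J (b 0) (b 1) hi
        exact ⟨hb.lie_one_two ▸ lie_mem_right ℝ 𝔤 J (b 1) (b 2) h2, hi, h2⟩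
      · have h0 : b 0 ∈ J := hb.lie_one_two ▸ lie_mem_right ℝ 𝔤 J (b 1) (b 2) hi
        exact ⟨h0, hb.lie_two_zero ▸ lie_mem_right ℝ 𝔤 J (b 2) (b 0) h0, hi⟩
    suffices h : ∃ i, b i ∈ J by
      obtain ⟨i, hi⟩ := h
      obtain ⟨h0, h1, h2⟩ := hcycle i hi
      rw [eq_top_iff]
      intro v _
      rw [← b.sum_repr v, Fin.sum_univ_three]
      exact J.add_mem (J.add_mem (J.smul_mem _ h0) (J.smul_mem _ h1)) (J.smul_mem _ h2)
    have hexp : w = b.repr w 0 • b 0 + b.repr w 1 • b 1 + b.repr w 2 • b 2 := by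
      rw [← Fin.sum_univ_three fun i => b.repr w i • b i, b.sum_repr]
    have e0 : ⁅b 1, ⁅b 0, w⁆⁆ = b.repr w 1 • b 0 := by
      rw [hexp]
      simp [lie_add, lie_smul, hb.lie_zero_one, hb.lie_one_two, hb.lie_zero_two]
    have e1 : ⁅b 0, ⁅b 1, w⁆⁆ = b.repr w 0 • b 1 := by
      rw [hexp]
      simp [lie_add, lie_smul, hb.lie_one_zero, hb.lie_one_two, hb.lie_zero_two]
    have e2 : ⁅b 2, ⁅b 0, w⁆⁆ = b.repr w 2 • b 0 := by
      rw [hexp]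
      simp [lie_add, lie_smul, hb.lie_zero_one, hb.lie_two_one, hb.lie_zero_two]
    have hmem : ∀ u v : 𝔤, ⁅u, ⁅v, w⁆⁆ ∈ J := fun u v =>
      lie_mem_right ℝ 𝔤 J u _ (lie_mem_right ℝ 𝔤 J v w hw)
    by_cases h1 : b.repr w 1 = 0
    · by_cases h0 : b.repr w 0 = 0
      · have h2 : b.repr w 2 ≠ 0 := fun h2 => hw0 <| by rw [hexp, h0, h1, h2]; simp
        exact ⟨0, key _ _ h2 (e2 ▸ hmem _ _)⟩
      · exact ⟨1, key _ _ h0 (e1 ▸ hmem _ _)⟩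
    · exact ⟨0, key _ _ h1 (e0 ▸ hmem _ _)⟩

lemma exists_basis_isCyclicTriple {K : LieSubalgebra ℝ 𝔤} {I : LieIdeal ℝ K} {s : Fin 3 → 𝔤}
    (hs : IsCyclicTriple s) (hli : LinearIndependent ℝ s)
    (hI : I.toSubmodule.map K.toSubmodule.subtype = Submodule.span ℝ (Set.range s)) :
    ∃ b : Module.Basis (Fin 3) ℝ I, IsCyclicTriple b := by
  have hmem : ∀ i, ∃ t : I, ((t : K) : 𝔤) = s i := fun i => by
    have h1 : s i ∈ I.toSubmodule.map K.toSubmodule.subtype :=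
      hI ▸ Submodule.subset_span (Set.mem_range_self i)
    obtain ⟨u, hu, hui⟩ := h1
    exact ⟨⟨u, hu⟩, hui⟩
  choose t ht using hmem
  let f : I →ₗ[ℝ] 𝔤 := K.toSubmodule.subtype ∘ₗ I.toSubmodule.subtype
  have hf : Function.Injective f := fun u v huv => Subtype.ext (Subtype.ext huv)
  have hft : f ∘ t = s := funext ht
  have hlit : LinearIndependent ℝ t := LinearIndependent.of_comp f (hft ▸ hli)
  have hspan : ⊤ ≤ Submodule.span ℝ (Set.range t) := by
    intro u _
    have h1 : f u ∈ Submodule.span ℝ (Set.range s) := hI ▸ ⟨(u : K), u.2, rfl⟩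
    rw [← hft, Set.range_comp, Submodule.span_image] at h1
    obtain ⟨u', hu', h2⟩ := h1
    exact hf h2 ▸ hu'
  refine ⟨Module.Basis.mk hlit hspan, ?_, ?_, ?_⟩ <;>
    simp only [Module.Basis.mk_apply] <;> apply hf
  · exact (congrArg₂ _ (ht 0) (ht 1)).trans (hs.lie_zero_one.trans (ht 2).symm)
  · exact (congrArg₂ _ (ht 1) (ht 2)).trans (hs.lie_one_two.trans (ht 0).symm)
  · exact (congrArg₂ _ (ht 2) (ht 0)).trans (hs.lie_two_zero.trans (ht 1).symm)

/-- By the Jacobi identity the elements that map `N` to itself form a Lie subalgebra, so stability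
needs checking only on generators. -/
lemma exists_lieIdeal_lieSpan {S : Set 𝔤} {N : Submodule ℝ 𝔤}
    (hN : N ≤ (LieSubalgebra.lieSpan ℝ 𝔤 S).toSubmodule) (h : ∀ u ∈ S, ∀ v ∈ N, ⁅u, v⁆ ∈ N) :
    ∃ I : LieIdeal ℝ (LieSubalgebra.lieSpan ℝ 𝔤 S),
      I.toSubmodule.map (LieSubalgebra.lieSpan ℝ 𝔤 S).toSubmodule.subtype = N := by
  have h' : ∀ u ∈ LieSubalgebra.lieSpan ℝ 𝔤 S, ∀ v ∈ N, ⁅u, v⁆ ∈ N := by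
    intro u hu
    induction hu using LieSubalgebra.lieSpan_induction with
    | mem u hu => exact h u hu
    | zero => exact fun v _ => by simp
    | add u w _ _ hu hw => exact fun v hv => add_lie u w v ▸ N.add_mem (hu v hv) (hw v hv)
    | smul c u _ hu => exact fun v hv => smul_lie c u v ▸ N.smul_mem c (hu v hv)
    | lie u w _ _ hu hw =>
      exact fun v hv => lie_lie u w v ▸ N.sub_mem (hu _ (hw v hv)) (hw _ (hu v hv))
  refine ⟨{ N.comap (LieSubalgebra.lieSpan ℝ 𝔤 S).toSubmodule.subtype with
    lie_mem := fun {u v} hv => h' u u.2 v hv }, ?_⟩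
  refine le_antisymm (Submodule.map_comap_le _ _) fun v hv => ⟨⟨v, hN hv⟩, hv, rfl⟩

/-- The trace of `J` on `I` is an ideal of `I`, hence zero or all of `I`. -/
lemma inf_eq_bot_of_isSimple {I J : LieIdeal ℝ 𝔤} (hI : LieAlgebra.IsSimple ℝ I) (h : ¬ I ≤ J) :
    I ⊓ J = ⊥ := by
  rcases hI.eq_bot_or_eq_top (J.comap I.incl) with h1 | h1
  · rw [eq_bot_iff]
    intro v hv
    rw [LieSubmodule.mem_inf] at hv
    have h2 : (⟨v, hv.1⟩ : I) ∈ J.comap I.incl := LieIdeal.mem_comap.2 hv.2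
    rw [h1, LieSubmodule.mem_bot] at h2
    exact (LieSubmodule.mem_bot v).2 (congrArg Subtype.val h2)
  · refine absurd (fun v hv => ?_) h
    have h2 : (⟨v, hv⟩ : I) ∈ J.comap I.incl := h1 ▸ LieSubmodule.mem_top _
    exact LieIdeal.mem_comap.1 h2

/-- The action of the generators `A₀`, `A₁` on a triple `P`, `Q`, `Z`. -/
structure IsRootTriple (A₀ A₁ : 𝔤) (x : ℝ) (P Q Z : 𝔤) : Prop where
  sq_lt : x ^ 2 < 4
  ne_zero : Z ≠ 0
  lie_P : ⁅A₀, P⁆ = (4 : ℝ) • Z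
  lie_Q : ⁅A₀, Q⁆ = (2 * x) • Z
  lie_Z : ⁅A₀, Z⁆ = (-4 : ℝ) • P
  lie_P' : ⁅A₁, P⁆ = (2 * x) • Z
  lie_Q' : ⁅A₁, Q⁆ = (4 : ℝ) • Z
  lie_Z' : ⁅A₁, Z⁆ = (-4 : ℝ) • Q

/-! ### Structure of a root triple -/

namespace IsRootTriple

variable {A₀ A₁ P Q Z : 𝔤} {x : ℝ} (h : IsRootTriple A₀ A₁ x P Q Z)
include h

lemma lie_comb (p q z : ℝ) :
    ⁅A₀, p • P + q • Q + z • Z⁆ = (4 * p + 2 * x * q) • Z - (4 * z) • P := by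
  simp only [lie_add, lie_smul, h.lie_P, h.lie_Q, h.lie_Z]
  module

lemma lie_comb' (p q z : ℝ) :
    ⁅A₁, p • P + q • Q + z • Z⁆ = (2 * x * p + 4 * q) • Z - (4 * z) • Q := by
  simp only [lie_add, lie_smul, h.lie_P', h.lie_Q', h.lie_Z']
  module

lemma eq_zero_of_lie_eq_zero {p q z : ℝ} (h0 : ⁅A₀, p • P + q • Q + z • Z⁆ = 0) :
    4 * p + 2 * x * q = 0 ∧ z = 0 := by
  rw [h.lie_comb] at h0
  have h1 : ⁅A₀, (4 * p + 2 * x * q) • Z - (4 * z) • P⁆ = 0 := by rw [h0, lie_zero]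
  rw [lie_sub, lie_smul, lie_smul, h.lie_P, h.lie_Z] at h1
  -- Bracketing with `A₀` a second time allows `P` to be eliminated, leaving a sum of squares times
  -- `Z`.
  have h2 : ((4 * p + 2 * x * q) ^ 2 + 16 * z ^ 2) • Z = 0 := by
    linear_combination (norm := module) (4 * p + 2 * x * q) • h0 - z • h1
  have h3 := (smul_eq_zero.1 h2).resolve_right h.ne_zero
  constructor <;> nlinarith

lemma eq_zero_of_lie_eq_zero' {p q z : ℝ} (h0 : ⁅A₁, p • P + q • Q + z • Z⁆ = 0) :
    2 * x * p + 4 * q = 0 ∧ z = 0 := by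
  rw [h.lie_comb'] at h0
  have h1 : ⁅A₁, (2 * x * p + 4 * q) • Z - (4 * z) • Q⁆ = 0 := by rw [h0, lie_zero]
  rw [lie_sub, lie_smul, lie_smul, h.lie_Q', h.lie_Z'] at h1
  have h2 : ((2 * x * p + 4 * q) ^ 2 + 16 * z ^ 2) • Z = 0 := by
    linear_combination (norm := module) (2 * x * p + 4 * q) • h0 - z • h1
  have h3 := (smul_eq_zero.1 h2).resolve_right h.ne_zero
  constructor <;> nlinarith

/-- The two generators give a linear system for `p` and `q` whose determinant is a nonzero multiple
of `4 - x ^ 2`. -/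
lemma eq_zero_of_comb_eq_zero {p q z : ℝ} (h0 : p • P + q • Q + z • Z = 0) :
    p = 0 ∧ q = 0 ∧ z = 0 := by
  obtain ⟨h1, hz⟩ := h.eq_zero_of_lie_eq_zero (p := p) (q := q) (z := z) (by rw [h0, lie_zero])
  obtain ⟨h2, -⟩ := h.eq_zero_of_lie_eq_zero' (p := p) (q := q) (z := z) (by rw [h0, lie_zero])
  have hx : 4 - x ^ 2 ≠ 0 := by linarith [h.sq_lt]
  have hp : p * (4 - x ^ 2) = 0 := by linear_combination h1 - x / 2 * h2
  have hq : q * (4 - x ^ 2) = 0 := by linear_combination h2 - x / 2 * h1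
  exact ⟨(mul_eq_zero.1 hp).resolve_right hx, (mul_eq_zero.1 hq).resolve_right hx, hz⟩

/-- `Z` is an eigenvector of `ad A₁ ∘ ad A₀` with eigenvalue `-8x` and of `(ad A₀)²` with eigenvalue
`-16`. In the span for `y` the second condition leaves no `Q'` component, and the first then leaves
nothing, because there `Z'` has eigenvalue `-8y`. -/
lemma notMem_span {y : ℝ} {P' Q' Z' : 𝔤} (h' : IsRootTriple A₀ A₁ y P' Q' Z') (hxy : x ≠ y) :
    Z ∉ Submodule.span ℝ {P', Q', Z'} := by
  intro hZ
  obtain ⟨p, q, z, hZ⟩ := Submodule.mem_span_triple.1 hZ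
  have e1 : ⁅A₁, ⁅A₀, Z⁆⁆ = (-8 * x) • Z := by
    rw [h.lie_Z, lie_smul, h.lie_P', smul_smul]
    congr 1
    ring
  rw [← hZ, h'.lie_comb, lie_sub, lie_smul, lie_smul, h'.lie_Z', h'.lie_P'] at e1
  have e2 : (8 * x * p) • P' + (8 * x * q - 4 * (4 * p + 2 * y * q)) • Q'
      + (8 * x * z - 8 * y * z) • Z' = 0 := by
    linear_combination (norm := module) e1
  have e3 : ⁅A₀, ⁅A₀, Z⁆⁆ = (-16 : ℝ) • Z := by
    rw [h.lie_Z, lie_smul, h.lie_P, smul_smul]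
    congr 1
    norm_num
  rw [← hZ, h'.lie_comb, lie_sub, lie_smul, lie_smul, h'.lie_Z, h'.lie_P] at e3
  have e4 : (16 * p - 4 * (4 * p + 2 * y * q)) • P' + (16 * q) • Q' + (0 : ℝ) • Z' = 0 := by
    linear_combination (norm := module) e3
  obtain ⟨-, f2, f3⟩ := h'.eq_zero_of_comb_eq_zero e2
  obtain ⟨-, g2, -⟩ := h'.eq_zero_of_comb_eq_zero e4
  have hq : q = 0 := by linarith
  have hp : p = 0 := by rw [hq] at f2; linarith
  have hz : z = 0 := by
    have : (x - y) * z = 0 := by linear_combination f3 / 8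
    exact (mul_eq_zero.1 this).resolve_left (sub_ne_zero.2 hxy)
  exact h.ne_zero (by rw [← hZ, hp, hq, hz]; simp)

/-- By Jacobi `[A₀, [P, Z]] = 0` and `[A₁, [Q, Z]] = 0`, which leaves one unknown in each bracket.
They are tied together by `[A₁, [P, Z]] = -4 [P, Q] = -[A₀, [Q, Z]]`, because `x² ≠ 4`. -/
lemma exists_lie_eq (hPZ : ⁅P, Z⁆ ∈ Submodule.span ℝ {P, Q, Z})
    (hQZ : ⁅Q, Z⁆ ∈ Submodule.span ℝ {P, Q, Z}) :
    ∃ α : ℝ, ⁅P, Z⁆ = α • (x • P - (2 : ℝ) • Q) ∧ ⁅Q, Z⁆ = α • ((2 : ℝ) • P - x • Q) ∧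
      ⁅P, Q⁆ = (α * (4 - x ^ 2) / 2) • Z := by
  obtain ⟨p, q, z, h1⟩ := Submodule.mem_span_triple.1 hPZ
  obtain ⟨p', q', z', h2⟩ := Submodule.mem_span_triple.1 hQZ
  have k1 : ⁅A₀, ⁅P, Z⁆⁆ = 0 := by
    rw [leibniz_lie, h.lie_P, h.lie_Z]; simp
  have k2 : ⁅A₁, ⁅Q, Z⁆⁆ = 0 := by
    rw [leibniz_lie, h.lie_Q', h.lie_Z']; simp
  have k3 : ⁅A₁, ⁅P, Z⁆⁆ = (-4 : ℝ) • ⁅P, Q⁆ := by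
    rw [leibniz_lie, h.lie_P', h.lie_Z']; simp
  have k4 : ⁅A₀, ⁅Q, Z⁆⁆ = (4 : ℝ) • ⁅P, Q⁆ := by
    rw [leibniz_lie, h.lie_Q, h.lie_Z, lie_smul (-4 : ℝ) Q P, smul_lie, lie_self, ← lie_skew Q P]
    module
  rw [← h1] at k1 k3
  rw [← h2] at k2 k4
  obtain ⟨m1, hz⟩ := h.eq_zero_of_lie_eq_zero k1
  obtain ⟨m2, hz'⟩ := h.eq_zero_of_lie_eq_zero' k2
  rw [h.lie_comb'] at k3
  rw [h.lie_comb] at k4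
  have hp : p = -(x * q) / 2 := by linarith
  have hq' : q' = -(x * p') / 2 := by linarith
  subst hz hz' hp hq'
  have k5 : ((4 - x ^ 2) * (p' + q)) • Z = 0 := by
    linear_combination (norm := module) k3 + k4
  have hx : 4 - x ^ 2 ≠ 0 := by linarith [h.sq_lt]
  have hqp : p' = -q := by
    have := (mul_eq_zero.1 ((smul_eq_zero.1 k5).resolve_right h.ne_zero)).resolve_left hx
    linarith
  subst hqp
  refine ⟨-q / 2, ?_, ?_, ?_⟩
  · rw [← h1]; module
  · rw [← h2]; module
  · linear_combination (norm := module) (1 / 4 : ℝ) • k3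

lemma exists_isCyclicTriple (hPZ : ⁅P, Z⁆ ∈ Submodule.span ℝ {P, Q, Z})
    (hQZ : ⁅Q, Z⁆ ∈ Submodule.span ℝ {P, Q, Z}) (h0 : ⁅P, Z⁆ ≠ 0) :
    ∃ s : Fin 3 → 𝔤, IsCyclicTriple s ∧ LinearIndependent ℝ s ∧
      Submodule.span ℝ (Set.range s) = Submodule.span ℝ {P, Q, Z} := by
  obtain ⟨α, h1, h2, h3⟩ := h.exists_lie_eq hPZ hQZ
  have hα : α ≠ 0 := fun hα => h0 (by rw [h1, hα, zero_smul])
  have hx := abs_lt.1 ((sq_lt_sq₀ (abs_nonneg x) zero_le_two).1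
    (by rw [sq_abs]; linarith [h.sq_lt] : |x| ^ 2 < 2 ^ 2))
  obtain ⟨u, hu, hu2⟩ : ∃ u : ℝ, 0 < u ∧ u ^ 2 = 2 - x :=
    ⟨√(2 - x), Real.sqrt_pos.2 (by linarith), Real.sq_sqrt (by linarith)⟩
  obtain ⟨v, hv, hv2⟩ : ∃ v : ℝ, 0 < v ∧ v ^ 2 = 2 + x :=
    ⟨√(2 + x), Real.sqrt_pos.2 (by linarith), Real.sq_sqrt (by linarith)⟩
  have hxu : x = 2 - u ^ 2 := by linarith
  have hvu : v ^ 2 = 4 - u ^ 2 := by linarith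
  have h4 : ⁅Q, P⁆ = -(α * (4 - x ^ 2) / 2) • Z := by rw [← lie_skew, h3, neg_smul]
  have h5 : ⁅Z, P⁆ = -(α • (x • P - (2 : ℝ) • Q)) := by rw [← lie_skew, h1]
  -- These scalars solve `e1`, `e2`, `e3` below, which encode `[P + Q, P - Q] = -α u² v² Z`, `[P -
  -- Q, Z] = -α u² (P + Q)` and `[Z, P + Q] = -α v² (P - Q)`.
  set r : ℝ := 1 / (α * u * v ^ 2) with hr
  set s : ℝ := 1 / (α * u ^ 2 * v) with hs
  set t : ℝ := -(1 / (α * u * v)) with ht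
  have hr0 : r ≠ 0 := by positivity
  have hs0 : s ≠ 0 := by positivity
  have ht0 : t ≠ 0 := neg_ne_zero.2 (by positivity)
  have e1 : t = -(r * s * α * (u ^ 2 * v ^ 2)) := by rw [hr, hs, ht]; field_simp
  have e2 : r = -(s * t * α * u ^ 2) := by rw [hr, hs, ht]; field_simp
  have e3 : s = -(t * r * α * v ^ 2) := by rw [hr, hs, ht]; field_simp
  clear_value r s t
  refine ⟨![r • (P + Q), s • (P - Q), t • Z], ⟨?_, ?_, ?_⟩, ?_, ?_⟩
  · change ⁅r • (P + Q), s • (P - Q)⁆ = t • Z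
    simp only [lie_smul, smul_lie, add_lie, lie_sub, lie_self, h3, h4]
    rw [e1, hvu, hxu]
    module
  · change ⁅s • (P - Q), t • Z⁆ = r • (P + Q)
    simp only [lie_smul, smul_lie, sub_lie, h1, h2]
    rw [e2, hxu]
    module
  · change ⁅t • Z, r • (P + Q)⁆ = s • (P - Q)
    rw [← lie_skew]
    simp only [lie_smul, smul_lie, add_lie, h1, h2]
    rw [e3, hvu, hxu]
    module
  · rw [Fintype.linearIndependent_iff]
    intro g hg
    rw [Fin.sum_univ_three] at hg
    change g 0 • r • (P + Q) + g 1 • s • (P - Q) + g 2 • t • Z = 0 at hg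
    obtain ⟨f1, f2, f3⟩ := h.eq_zero_of_comb_eq_zero (p := g 0 * r + g 1 * s)
      (q := g 0 * r - g 1 * s) (z := g 2 * t) (by linear_combination (norm := module) hg)
    have g0 : g 0 = 0 :=
      (mul_eq_zero.1 (by linear_combination (f1 + f2) / 2 : g 0 * r = 0)).resolve_right hr0
    have g1 : g 1 = 0 :=
      (mul_eq_zero.1 (by linear_combination (f1 - f2) / 2 : g 1 * s = 0)).resolve_right hs0
    have g2 : g 2 = 0 := (mul_eq_zero.1 f3).resolve_right ht0
    intro i
    fin_cases i <;> assumption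
  · rw [Matrix.range_cons, Matrix.range_cons, Matrix.range_cons, Matrix.range_empty,
      Set.union_empty, Set.singleton_union, Set.singleton_union]
    exact span_add_sub_eq hr0 hs0 ht0 P Q Z

end IsRootTriple

end SuTwo

/-! ### Tensor products of `2 × 2` matrices -/

section Tensor

variable {n : ℕ}

lemma tensor_mul (M N : Fin n → Matrix (Fin 2) (Fin 2) ℂ) :
    tensor M * tensor N = tensor fun j => M j * N j := by
  ext s t
  simp only [tensor, Matrix.mul_apply, Matrix.of_apply, ← Finset.prod_mul_distrib]
  rw [Finset.prod_univ_sum, Fintype.piFinset_univ]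

lemma tensor_one : tensor (fun _ : Fin n => (1 : Matrix (Fin 2) (Fin 2) ℂ)) = 1 := by
  ext s t
  simp only [tensor, Matrix.of_apply, Matrix.one_apply, Finset.prod_ite_zero,
    Finset.prod_const_one, Finset.mem_univ, forall_const, funext_iff]

lemma conjTranspose_tensor (M : Fin n → Matrix (Fin 2) (Fin 2) ℂ) :
    (tensor M).conjTranspose = tensor fun j => (M j).conjTranspose := by
  ext s t
  simp [tensor, Matrix.conjTranspose_apply]

lemma tensor_eq_smul {M N : Fin n → Matrix (Fin 2) (Fin 2) ℂ} (c : ℂ) (j : Fin n)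
    (hj : M j = c • N j) (h : ∀ k ≠ j, M k = N k) : tensor M = c • tensor N := by
  ext s t
  simp only [tensor, Matrix.of_apply, Matrix.smul_apply, smul_eq_mul]
  rw [← Finset.mul_prod_erase _ _ (Finset.mem_univ j),
    ← Finset.mul_prod_erase _ (fun k => N k (s k) (t k)) (Finset.mem_univ j), hj,
    Finset.prod_congr rfl fun k hk => by rw [h k (Finset.ne_of_mem_erase hk)]]
  simp [mul_assoc]

lemma site_eq (σ : Matrix (Fin 2) (Fin 2) ℂ) (j : Fin n) :
    site σ j = tensor fun k => if k = j then σ else 1 := by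
  rw [site]
  congr 1
  funext k
  rw [Function.update_apply]

lemma site_mul_site_same (σ τ : Matrix (Fin 2) (Fin 2) ℂ) (j : Fin n) :
    site σ j * site τ j = site (σ * τ) j := by
  simp only [site_eq, tensor_mul]
  congr 1
  funext k
  split_ifs <;> simp

lemma commute_site_of_ne (σ τ : Matrix (Fin 2) (Fin 2) ℂ) {j k : Fin n} (h : j ≠ k) :
    Commute (site σ j) (site τ k) := by
  simp only [Commute, SemiconjBy, site_eq, tensor_mul]
  congr 1
  funext l
  split_ifs with h1 h2
  · exact absurd (h1.symm.trans h2) h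
  all_goals simp

lemma commute_site_self (σ : Matrix (Fin 2) (Fin 2) ℂ) (j k : Fin n) :
    Commute (site σ j) (site σ k) := by
  rcases eq_or_ne j k with rfl | h
  · exact Commute.refl _
  · exact commute_site_of_ne σ σ h

lemma site_one (j : Fin n) : site 1 j = 1 := by
  rw [site_eq, ← tensor_one]
  simp

lemma site_neg (σ : Matrix (Fin 2) (Fin 2) ℂ) (j : Fin n) : site (-σ) j = -site σ j := by
  rw [site_eq, site_eq, ← neg_one_smul ℂ (tensor _)]
  exact tensor_eq_smul (-1) j (by simp) fun k hk => by simp [hk]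

end Tensor

/-! ### Identities for the Pauli matrices -/

lemma sigmaX_mul_self : sigmaX * sigmaX = 1 := by
  ext i j; fin_cases i <;> fin_cases j <;> simp [sigmaX]

lemma sigmaZ_mul_self : sigmaZ * sigmaZ = 1 := by
  ext i j; fin_cases i <;> fin_cases j <;> simp [sigmaZ]

lemma sigmaX_mul_sigmaZ : sigmaX * sigmaZ = Complex.I • sigmaY := by
  ext i j; fin_cases i <;> fin_cases j <;> simp [sigmaX, sigmaY, sigmaZ]

lemma sigmaZ_mul_sigmaX : sigmaZ * sigmaX = (-Complex.I) • sigmaY := by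
  ext i j; fin_cases i <;> fin_cases j <;> simp [sigmaX, sigmaY, sigmaZ]

lemma sigmaY_mul_sigmaZ : sigmaY * sigmaZ = (-Complex.I) • sigmaX := by
  ext i j; fin_cases i <;> fin_cases j <;> simp [sigmaX, sigmaY, sigmaZ]

lemma conjTranspose_sigmaX : sigmaX.conjTranspose = sigmaX := by
  ext i j; fin_cases i <;> fin_cases j <;> simp [sigmaX]

lemma conjTranspose_sigmaZ : sigmaZ.conjTranspose = sigmaZ := by
  ext i j; fin_cases i <;> fin_cases j <;> simp [sigmaZ]

section Translation

variable {n : ℕ}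

lemma sigmaX_site_mul_sigmaZ_site (j : Fin n) :
    site sigmaX j * site sigmaZ j = -(site sigmaZ j * site sigmaX j) := by
  rw [site_mul_site_same, site_mul_site_same, ← site_neg, sigmaX_mul_sigmaZ, sigmaZ_mul_sigmaX,
    neg_smul, neg_neg]

lemma conjTranspose_site {σ : Matrix (Fin 2) (Fin 2) ℂ} (h : σ.conjTranspose = σ) (j : Fin n) :
    (site σ j).conjTranspose = site σ j := by
  rw [site_eq, conjTranspose_tensor]
  congr 1
  funext k
  split_ifs <;> simp [h]

/-! ### Translations -/

lemma translation_mul_tensor_mul (k : ℕ) (M : Fin n → Matrix (Fin 2) (Fin 2) ℂ) :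
    translation n k * tensor M * (translation n k).transpose
      = tensor fun j => M ((finRotate n ^ k) j) := by
  ext s t
  rw [translation, Matrix.transpose_permMatrix, Equiv.Perm.permMatrix, Equiv.Perm.permMatrix,
    PEquiv.toMatrix_toPEquiv_mul, PEquiv.mul_toMatrix_toPEquiv]
  simp only [Matrix.submatrix_apply, tensor, Matrix.of_apply]
  rw [← Equiv.prod_comp (finRotate n ^ k)]
  refine Finset.prod_congr rfl fun j _ => ?_
  congr 1 <;> simp [Equiv.arrowCongr, Equiv.Perm.inv_def]

lemma transpose_translation_mul (k : ℕ) :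
    (translation n k).transpose * translation n k = 1 := by
  rw [translation, Matrix.transpose_permMatrix, ← Matrix.permMatrix_mul, mul_inv_cancel,
    Matrix.permMatrix_one]

/-- Conjugation by a translation. -/
def conjTranslation (n k : ℕ) (A : Op n) : Op n :=
  translation n k * A * (translation n k).transpose

lemma conjTranslation_mul (k : ℕ) (A B : Op n) :
    conjTranslation n k (A * B) = conjTranslation n k A * conjTranslation n k B := by
  have h : conjTranslation n k A * conjTranslation n k B = translation n k * A
      * ((translation n k).transpose * translation n k) * B * (translation n k).transpose := by
    simp only [conjTranslation, mul_assoc]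
  rw [h, transpose_translation_mul, mul_one, conjTranslation, mul_assoc (translation n k) A B]

lemma conjTranslation_one (k : ℕ) : conjTranslation n k 1 = 1 := by
  rw [← tensor_one, conjTranslation, translation_mul_tensor_mul]

end Translation

/-! ### The chain of the transverse field and interaction terms -/

/-- The alternating sequence `σ_x^0`, `σ_z^0 σ_z^1`, `σ_x^1`, `σ_z^1 σ_z^2`, …, with the sites
taken modulo `n`. -/
noncomputable def gen (n : ℕ) [NeZero n] (i : ℕ) : Op n :=
  if i % 2 = 0 then site sigmaX (Fin.ofNat n (i / 2))
  else site sigmaZ (Fin.ofNat n (i / 2)) * site sigmaZ (Fin.ofNat n (i / 2 + 1))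

section Gen

variable {n : ℕ} [NeZero n]

lemma gen_two_mul (k : ℕ) : gen n (2 * k) = site sigmaX (Fin.ofNat n k) := by
  rw [gen, if_pos (by omega), show 2 * k / 2 = k by omega]

lemma gen_two_mul_add_one (k : ℕ) :
    gen n (2 * k + 1) = site sigmaZ (Fin.ofNat n k) * site sigmaZ (Fin.ofNat n (k + 1)) := by
  rw [gen, if_neg (by omega), show (2 * k + 1) / 2 = k by omega]

lemma ofNat_add_ne (k : ℕ) {u : ℕ} (h0 : 0 < u) (hu : u < n) :
    Fin.ofNat n k ≠ Fin.ofNat n (k + u) := by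
  intro h
  have h1 : k + 0 ≡ k + u [MOD n] := congrArg Fin.val h
  have h2 : 0 % n = u % n := Nat.ModEq.add_left_cancel' k h1
  rw [Nat.zero_mod, Nat.mod_eq_of_lt hu] at h2
  omega

lemma ofNat_add_self (k : ℕ) : Fin.ofNat n (k + n) = Fin.ofNat n k :=
  Fin.ext (by simp)

/-- Signs arise only where `σ_x` meets `σ_z` on one site. Neighbours share exactly one such site;
members further apart are of the same type or act on disjoint sites. -/
lemma isChain_gen (hn : 2 ≤ n) : IsChain n (gen n) where
  two_le := hn
  sq i := by
    obtain ⟨k, rfl | rfl⟩ := i.even_or_odd'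
    · rw [gen_two_mul, site_mul_site_same, sigmaX_mul_self, site_one]
    · rw [gen_two_mul_add_one, mul_assoc, (commute_site_self sigmaZ (Fin.ofNat n k) _).symm.left_comm,
        site_mul_site_same, ← mul_assoc, site_mul_site_same, sigmaZ_mul_self, site_one, site_one,
        one_mul]
  anti i := by
    obtain ⟨k, rfl | rfl⟩ := i.even_or_odd'
    · have h := commute_site_of_ne sigmaX sigmaZ (ofNat_add_ne k one_pos hn)
      rw [gen_two_mul, gen_two_mul_add_one, ← mul_assoc, sigmaX_site_mul_sigmaZ_site, neg_mul,
        mul_assoc, mul_assoc, h.eq]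
    · have h := commute_site_of_ne sigmaZ sigmaX (ofNat_add_ne k one_pos hn)
      rw [gen_two_mul_add_one, show 2 * k + 1 + 1 = 2 * (k + 1) by ring, gen_two_mul, ← mul_assoc,
        ← h.eq, mul_assoc, mul_assoc, sigmaX_site_mul_sigmaZ_site, mul_neg, neg_neg]
  comm i t h1 h2 := by
    obtain ⟨k, rfl | rfl⟩ := i.even_or_odd' <;> obtain ⟨u, rfl | rfl⟩ := t.even_or_odd'
    · rw [← mul_add, gen_two_mul, gen_two_mul]
      exact commute_site_self _ _ _
    · rw [← add_assoc, ← mul_add, gen_two_mul, gen_two_mul_add_one]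
      exact (commute_site_of_ne _ _ (ofNat_add_ne k (by omega) (by omega))).mul_right
        (commute_site_of_ne _ _ (ofNat_add_ne k (u := u + 1) (by omega) (by omega)))
    · rw [add_right_comm, ← mul_add, gen_two_mul_add_one, gen_two_mul_add_one]
      exact ((commute_site_self _ _ _).mul_right (commute_site_self _ _ _)).mul_left
        ((commute_site_self _ _ _).mul_right (commute_site_self _ _ _))
    · rw [show 2 * k + 1 + (2 * u + 1) = 2 * (k + (u + 1)) by ring, gen_two_mul,
        gen_two_mul_add_one]
      refine (commute_site_of_ne _ _ (ofNat_add_ne k (by omega) (by omega))).mul_left ?_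
      rw [← add_assoc, add_right_comm]
      exact commute_site_of_ne _ _ (ofNat_add_ne (k + 1) (by omega) (by omega))
  period i := by
    obtain ⟨k, rfl | rfl⟩ := i.even_or_odd'
    · rw [← mul_add, gen_two_mul, gen_two_mul, ofNat_add_self]
    · rw [add_right_comm, ← mul_add, gen_two_mul_add_one, gen_two_mul_add_one, ofNat_add_self,
        add_right_comm, ofNat_add_self]

lemma finRotate_ofNat (j : ℕ) : finRotate n (Fin.ofNat n j) = Fin.ofNat n (j + 1) := by
  rw [finRotate_apply]
  ext
  simp [Fin.val_add]

lemma finRotate_pow_ofNat (j k : ℕ) :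
    (finRotate n ^ k) (Fin.ofNat n j) = Fin.ofNat n (j + k) := by
  induction k with
  | zero => rfl
  | succ k ih => rw [pow_succ', Equiv.Perm.mul_apply, ih, finRotate_ofNat, add_assoc]

lemma conjTranslation_site (σ : Matrix (Fin 2) (Fin 2) ℂ) (j k : ℕ) :
    conjTranslation n k (site σ (Fin.ofNat n (j + k))) = site σ (Fin.ofNat n j) := by
  rw [site_eq, conjTranslation, translation_mul_tensor_mul, site_eq]
  simp only [← finRotate_pow_ofNat, EmbeddingLike.apply_eq_iff_eq]

lemma conjTranslation_gen (i k : ℕ) : conjTranslation n k (gen n (i + 2 * k)) = gen n i := by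
  obtain ⟨j, rfl | rfl⟩ := i.even_or_odd'
  · rw [← mul_add, gen_two_mul, gen_two_mul, conjTranslation_site]
  · rw [add_right_comm, ← mul_add, gen_two_mul_add_one, gen_two_mul_add_one, conjTranslation_mul,
      conjTranslation_site, add_right_comm, conjTranslation_site]

lemma conjTranslation_word (i k l : ℕ) :
    conjTranslation n k (word (gen n) (i + 2 * k) l) = word (gen n) i l := by
  induction l with
  | zero => exact conjTranslation_one k
  | succ l ih => rw [word, conjTranslation_mul, ih, add_right_comm, conjTranslation_gen, word]

lemma symmetrize_word (hn : 2 ≤ n) (p l : ℕ) :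
    symmetrize (word (gen n) p l) = wordSum n (gen n) p l := by
  have h := isChain_gen hn
  have h1 : symmetrize (word (gen n) p l)
      = ∑ k ∈ Finset.range n, conjTranslation n k (word (gen n) p l) := rfl
  -- Conjugation by the `k`-th translation moves a word back by `2 * k` positions, so the two sums
  -- match after reversing one of them.
  rw [← h.wordSum_add_two, h1, wordSum, ← Finset.sum_range_reflect]
  refine Finset.sum_congr rfl fun s hs => ?_
  rw [Finset.mem_range] at hs
  rw [← h.word_period, show p + 2 * n = p + 2 + 2 * s + 2 * (n - 1 - s) by omega,
    conjTranslation_word]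

end Gen

/-! ### Pauli strings as words in the chain -/

section Strings

variable {n : ℕ}

lemma symmetrize_smul (c : ℂ) (A : Op n) : symmetrize (c • A) = c • symmetrize A := by
  simp only [symmetrize, Matrix.mul_smul, Matrix.smul_mul, Finset.smul_sum]

variable [NeZero n]

lemma eq_ofNat_iff {k : ℕ} (hk : k < n) (t : Fin n) : t = Fin.ofNat n k ↔ (t : ℕ) = k := by
  rw [Fin.ext_iff, Fin.val_ofNat, Nat.mod_eq_of_lt hk]

lemma gen_even_eq {k : ℕ} (hk : k < n) :
    gen n (2 * k) = tensor fun t : Fin n => if (t : ℕ) = k then sigmaX else 1 := by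
  simp only [gen_two_mul, site_eq, eq_ofNat_iff hk]

lemma gen_odd_eq {k : ℕ} (hk : k + 1 < n) :
    gen n (2 * k + 1) = tensor fun t : Fin n =>
      if (t : ℕ) = k then sigmaZ else if (t : ℕ) = k + 1 then sigmaZ else 1 := by
  simp only [gen_two_mul_add_one, site_eq, tensor_mul, eq_ofNat_iff hk,
    eq_ofNat_iff (Nat.lt_of_succ_lt hk)]
  congr 1
  funext t
  split_ifs <;> first | omega | simp

lemma gen_last_eq (hn : 2 ≤ n) :
    gen n (2 * (n - 1) + 1) = tensor fun t : Fin n =>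
      if (t : ℕ) = n - 1 then sigmaZ else if (t : ℕ) = 0 then sigmaZ else 1 := by
  have h : Fin.ofNat n (n - 1 + 1) = Fin.ofNat n 0 := by
    rw [Nat.sub_add_cancel (by omega), ← ofNat_add_self 0, zero_add]
  simp only [gen_two_mul_add_one, h, site_eq, tensor_mul,
    eq_ofNat_iff (show n - 1 < n by omega), eq_ofNat_iff (show 0 < n by omega)]
  congr 1
  funext t
  split_ifs <;> first | omega | simp

/-- Two consecutive generators lengthen a string by one site: `σ_z σ_x = -i σ_y` turns its end into
`σ_y`, then `σ_y σ_z = -i σ_x` joins that site to the interior and leaves `σ_z` on the next.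
Together they contribute the sign `(-i)² = -1`. -/
lemma pauliString_mul_gen_even (A : Matrix (Fin 2) (Fin 2) ℂ) {j : ℕ} (hj : j + 1 < n) :
    pauliString n A sigmaZ j * gen n (2 * j + 2) = (-Complex.I) • pauliString n A sigmaY j := by
  rw [show 2 * j + 2 = 2 * (j + 1) by ring, gen_even_eq hj, pauliString, pauliString, tensor_mul]
  refine tensor_eq_smul _ ⟨j + 1, hj⟩ (by simp [sigmaZ_mul_sigmaX]) fun k hk => ?_
  replace hk : (k : ℕ) ≠ j + 1 := fun h => hk (Fin.ext h)
  split_ifs <;> first | omega | simp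

lemma pauliString_mul_gen_odd (A : Matrix (Fin 2) (Fin 2) ℂ) {j : ℕ} (hj : j + 2 < n) :
    pauliString n A sigmaY j * gen n (2 * j + 3)
      = (-Complex.I) • pauliString n A sigmaZ (j + 1) := by
  rw [show 2 * j + 3 = 2 * (j + 1) + 1 by ring, gen_odd_eq hj, pauliString, pauliString,
    tensor_mul]
  refine tensor_eq_smul _ ⟨j + 1, by omega⟩ (by simp [sigmaY_mul_sigmaZ]) fun k hk => ?_
  replace hk : (k : ℕ) ≠ j + 1 := fun h => hk (Fin.ext h)
  split_ifs <;> first | omega | simp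

lemma pauliString_mul_gen_last (hn : 2 ≤ n) :
    pauliString n sigmaZ sigmaY (n - 2) * gen n (2 * (n - 1) + 1)
      = (-Complex.I) • tensor fun t : Fin n => if (t : ℕ) = 0 then 1 else sigmaX := by
  rw [gen_last_eq hn, pauliString, tensor_mul]
  refine tensor_eq_smul _ ⟨n - 1, by omega⟩ ?_ fun k hk => ?_
  · simp only
    rw [if_neg (by omega), if_neg (by omega), if_pos (by omega), if_pos trivial,
      if_neg (by omega), sigmaY_mul_sigmaZ]
  · rw [Ne, Fin.ext_iff] at hk
    have := k.2
    simp only at hk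
    split_ifs <;> first | omega | simp [sigmaZ_mul_self]

lemma word_one_odd (j : ℕ) (hj : j + 1 < n) :
    word (gen n) 1 (2 * j + 1) = (-1 : ℂ) ^ j • pauliString n sigmaZ sigmaZ j := by
  induction j with
  | zero =>
    rw [word, word, one_mul, show 1 + 2 * 0 = 2 * 0 + 1 by rfl, gen_odd_eq hj, pow_zero, one_smul,
      pauliString]
    congr 1
    funext t
    split_ifs <;> first | omega | rfl
  | succ j ih =>
    have h1 := pauliString_mul_gen_even sigmaZ (n := n) (j := j) (by omega)
    have h2 := pauliString_mul_gen_odd sigmaZ (n := n) (j := j) (by omega)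
    rw [show 2 * (j + 1) + 1 = 2 * j + 1 + 1 + 1 by ring, word, word, ih (by omega),
      show 1 + (2 * j + 1) = 2 * j + 2 by ring, show 1 + (2 * j + 1 + 1) = 2 * j + 3 by ring,
      smul_mul_assoc, h1, smul_smul, smul_mul_assoc, h2, smul_smul]
    congr 1
    linear_combination (-1 : ℂ) ^ j * Complex.I_mul_I

lemma word_one_even {j : ℕ} (hj : j + 1 < n) :
    word (gen n) 1 (2 * j + 2)
      = ((-1 : ℂ) ^ j * -Complex.I) • pauliString n sigmaZ sigmaY j := by
  rw [word, word_one_odd j hj, show 1 + (2 * j + 1) = 2 * j + 2 by ring, smul_mul_assoc,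
    pauliString_mul_gen_even sigmaZ hj, smul_smul]

lemma word_zero_even (j : ℕ) (hj : j + 1 < n) :
    word (gen n) 0 (2 * j + 2)
      = ((-1 : ℂ) ^ j * Complex.I) • pauliString n sigmaY sigmaZ j := by
  induction j with
  | zero =>
    rw [word, word, word, one_mul, show 0 + 0 = 2 * 0 by rfl, gen_even_eq (by omega),
      show 2 * 0 + (2 * 0 + 1) = 2 * 0 + 1 by rfl, gen_odd_eq hj, pow_zero, one_mul,
      tensor_mul, pauliString]
    refine tensor_eq_smul _ ⟨0, by omega⟩ (by simp [sigmaX_mul_sigmaZ]) fun k hk => ?_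
    rw [Ne, Fin.ext_iff] at hk
    simp only at hk
    split_ifs <;> first | omega | simp
  | succ j ih =>
    have h1 := pauliString_mul_gen_even sigmaY (n := n) (j := j) (by omega)
    have h2 := pauliString_mul_gen_odd sigmaY (n := n) (j := j) (by omega)
    rw [show 2 * (j + 1) + 2 = 2 * j + 2 + 1 + 1 by ring, word, word, ih (by omega),
      show 0 + (2 * j + 2) = 2 * j + 2 by ring, show 0 + (2 * j + 2 + 1) = 2 * j + 3 by ring,
      smul_mul_assoc, h1, smul_smul, smul_mul_assoc, h2, smul_smul]
    congr 1
    linear_combination (-1 : ℂ) ^ j * Complex.I * Complex.I_mul_I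

lemma word_zero_odd {j : ℕ} (hj : j + 1 < n) :
    word (gen n) 0 (2 * j + 3) = (-1 : ℂ) ^ j • pauliString n sigmaY sigmaY j := by
  rw [word, word_zero_even j hj, show 0 + (2 * j + 2) = 2 * j + 2 by ring, smul_mul_assoc,
    pauliString_mul_gen_even sigmaY hj, smul_smul]
  congr 1
  linear_combination -(-1 : ℂ) ^ j * Complex.I_mul_I

/-- The last letter wraps around the ring, and its factor at site `0` cancels the initial `σ_z`. -/
lemma word_one_last (hn : 2 ≤ n) :
    word (gen n) 1 (2 * (n - 1) + 1)
      = (-1 : ℂ) ^ (n - 1) • tensor fun t : Fin n => if (t : ℕ) = 0 then 1 else sigmaX := by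
  obtain ⟨m, rfl⟩ : ∃ m, n = m + 2 := ⟨n - 2, by omega⟩
  have h := pauliString_mul_gen_last hn
  have h2 := word_one_even (n := m + 2) (j := m) (by omega)
  rw [show m + 2 - 2 = m by rfl, show m + 2 - 1 = m + 1 by rfl] at *
  rw [show 2 * (m + 1) + 1 = 2 * m + 2 + 1 by ring, word, h2,
    show 1 + (2 * m + 2) = 2 * (m + 1) + 1 by ring, smul_mul_assoc, h, smul_smul]
  congr 1
  linear_combination (-1 : ℂ) ^ m * Complex.I_mul_I

/-- The elements `A_{k+1}`, `k ≥ 0`, of the (finite) Onsager algebra: the strings `𝐙^k`. -/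
noncomputable def elU (n : ℕ) [NeZero n] (k : ℕ) : Op n :=
  ((-1 : ℂ) ^ k * Complex.I) • wordSum n (gen n) 1 (2 * k + 1)

/-- The elements `A_{-k}`, `k ≥ 0`, of the (finite) Onsager algebra: the strings `𝐘^{k-1}`. -/
noncomputable def elD (n : ℕ) [NeZero n] (k : ℕ) : Op n :=
  ((-1 : ℂ) ^ (k + 1) * Complex.I) • wordSum n (gen n) 0 (2 * k + 1)

/-- The elements `G_k` of the (finite) Onsager algebra: the strings `𝐘𝐙^{k-1}`. -/
noncomputable def elG (n : ℕ) [NeZero n] (k : ℕ) : Op n :=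
  (-1 : ℂ) ^ (k + 1) • (wordSum n (gen n) 0 (2 * k) - wordSum n (gen n) 1 (2 * k))

lemma elG_zero : elG n 0 = 0 := by
  simp [elG, wordSum, word]

lemma H0_eq : Complex.I • H0 n = elU n 0 := by
  rw [elU, wordSum_one_eq, H0, pow_zero, one_mul,
    ← Fin.sum_univ_eq_sum_range (fun s => gen n (1 + 2 * s)) n]
  congr 1
  refine Finset.sum_congr rfl fun j _ => ?_
  have h : j = Fin.ofNat n (j : ℕ) := by rw [eq_ofNat_iff j.2]
  rw [add_comm, gen_two_mul_add_one, ← finRotate_ofNat, ← h]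

lemma H1_eq : Complex.I • H1 n = -elD n 0 := by
  rw [elD, wordSum_one_eq, H1, ← neg_smul,
    ← Fin.sum_univ_eq_sum_range (fun s => gen n (0 + 2 * s)) n]
  congr 1
  · simp
  refine Finset.sum_congr rfl fun j _ => ?_
  have h : j = Fin.ofNat n (j : ℕ) := by rw [eq_ofNat_iff j.2]
  rw [zero_add, gen_two_mul, ← h]

variable (hn : 2 ≤ n)
include hn

lemma bZ_eq {j : ℕ} (hj : j + 1 < n) : bZ n j = elU n j := by
  rw [elU, ← symmetrize_word hn, word_one_odd j hj, symmetrize_smul, smul_smul, bZ]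
  congr 1
  rcases neg_one_pow_eq_or ℂ j with h | h <;> simp [h]

lemma bY_eq {j : ℕ} (hj : j + 1 < n) : bY n j = elD n (j + 1) := by
  rw [elD, ← symmetrize_word hn, show 2 * (j + 1) + 1 = 2 * j + 3 by ring, word_zero_odd hj,
    symmetrize_smul, smul_smul, bY]
  congr 1
  rcases neg_one_pow_eq_or ℂ j with h | h <;> simp [h, pow_succ]

lemma bYZ_eq {j : ℕ} (hj : j + 1 < n) : bYZ n j = elG n (j + 1) := by
  rw [elG, ← symmetrize_word hn, ← symmetrize_word hn, show 2 * (j + 1) = 2 * j + 2 by ring,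
    word_zero_even j hj, word_one_even hj, symmetrize_smul, symmetrize_smul, bYZ]
  rcases neg_one_pow_eq_or ℂ j with h | h <;> simp only [h, pow_succ] <;> module

lemma bX_eq : bX n = -elD n 0 := by
  have h : word (gen n) 0 (2 * 0 + 1)
      = tensor fun k : Fin n => if (k : ℕ) = 0 then sigmaX else 1 := by
    rw [word, word, one_mul, show 0 + 2 * 0 = 2 * 0 by rfl, gen_even_eq (by omega)]
  rw [elD, ← symmetrize_word hn, h, bX]
  module

/-- In `word_one_last` the identity factor is at site `0`; one translation brings it to site `n -
1`, and symmetrization does not see the difference. -/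
lemma bXX_eq : bXX n = elU n (n - 1) := by
  have h : tensor (fun k : Fin n => if (k : ℕ) < n - 1 then sigmaX else 1)
      = (-1 : ℂ) ^ (n - 1) • word (gen n) (1 + 2 * (n - 1)) (2 * (n - 1) + 1) := by
    have h1 : ∀ t : Fin n, ((finRotate n ^ 1) t : ℕ) = 0 ↔ (t : ℕ) = n - 1 := fun t => by
      rw [pow_one, finRotate_apply, Fin.val_add, Fin.val_one', Nat.add_mod_mod]
      rcases (show (t : ℕ) + 1 ≤ n from t.2).lt_or_eq with h | h
      · rw [Nat.mod_eq_of_lt h]; omega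
      · rw [h, Nat.mod_self]; omega
    rw [← conjTranslation_word _ 1, show 1 + 2 * (n - 1) + 2 * 1 = 1 + 2 * n by omega,
      (isChain_gen hn).word_period, word_one_last hn, conjTranslation, Matrix.mul_smul,
      Matrix.smul_mul, translation_mul_tensor_mul, smul_smul, ← mul_pow, neg_one_mul, neg_neg,
      one_pow, one_smul]
    congr 1
    funext t
    have := t.2
    simp only [h1]
    split_ifs <;> first | omega | rfl
  rw [bXX, h, symmetrize_smul, symmetrize_word hn, (isChain_gen hn).wordSum_add_two_mul, elU,
    smul_smul, mul_comm]

lemma elG_last : elG n n = 0 := by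
  have h := isChain_gen hn
  rw [elG, ← sum_word _ _ 1 0, wordSum]
  simp [h.word_full_succ]

/-! ### The Onsager relations -/

lemma lie_elD_elU {k : ℕ} (hk : k ≤ n - 1) : ⁅elD n 0, elU n k⁆ = (2 : ℝ) • elG n (k + 1) := by
  have h := (isChain_gen hn).lie_wordSum_odd_other 1 hk
  rw [(isChain_gen hn).wordSum_add_two 0, (isChain_gen hn).wordSum_add_two 0] at h
  rw [elD, elU, elG, smul_lie, lie_smul, h, ← Complex.coe_smul, mul_add 2 k 1]
  push_cast
  simp only [two_mul (wordSum _ _ _ _)]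
  match_scalars <;> first
    | linear_combination (2 * (-1 : ℂ) ^ k) * Complex.I_mul_I
    | linear_combination (-2 * (-1 : ℂ) ^ k) * Complex.I_mul_I

lemma lie_elD_elD {k : ℕ} (hk : k ≤ n - 1) : ⁅elD n 0, elD n k⁆ = (-2 : ℝ) • elG n k := by
  have h := (isChain_gen hn).lie_wordSum_odd_same 0 hk
  rw [elD, elD, elG, smul_lie, lie_smul, h, ← Complex.coe_smul]
  push_cast
  simp only [two_mul (wordSum _ _ _ _)]
  match_scalars <;> first
    | linear_combination (2 * (-1 : ℂ) ^ k) * Complex.I_mul_I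
    | linear_combination (-2 * (-1 : ℂ) ^ k) * Complex.I_mul_I

lemma lie_elU_elU {k : ℕ} (hk : k ≤ n - 1) : ⁅elU n 0, elU n k⁆ = (2 : ℝ) • elG n k := by
  have h := (isChain_gen hn).lie_wordSum_odd_same 1 hk
  rw [(isChain_gen hn).wordSum_add_two 0] at h
  rw [elU, elU, elG, smul_lie, lie_smul, h, ← Complex.coe_smul]
  push_cast
  simp only [two_mul (wordSum _ _ _ _)]
  match_scalars <;> first
    | linear_combination (2 * (-1 : ℂ) ^ k) * Complex.I_mul_I
    | linear_combination (-2 * (-1 : ℂ) ^ k) * Complex.I_mul_I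

lemma lie_elU_elD {k : ℕ} (hk : k ≤ n - 1) : ⁅elU n 0, elD n k⁆ = (-2 : ℝ) • elG n (k + 1) := by
  have h := (isChain_gen hn).lie_wordSum_odd_other 0 hk
  rw [elU, elD, elG, smul_lie, lie_smul, h, ← Complex.coe_smul, mul_add 2 k 1]
  push_cast
  simp only [two_mul (wordSum _ _ _ _)]
  match_scalars <;> first
    | linear_combination (2 * (-1 : ℂ) ^ k) * Complex.I_mul_I
    | linear_combination (-2 * (-1 : ℂ) ^ k) * Complex.I_mul_I

lemma lie_elD_elG {k : ℕ} (hk : k + 1 ≤ n - 1) :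
    ⁅elD n 0, elG n (k + 1)⁆ = (-4 : ℝ) • (elU n k - elD n (k + 1)) := by
  have h1 := (isChain_gen hn).lie_wordSum_even_same 0 hk
  have h2 := (isChain_gen hn).lie_wordSum_even_other 1 hk
  rw [(isChain_gen hn).wordSum_add_two 0, (isChain_gen hn).wordSum_add_two 0] at h2
  rw [elD, elU, elG, smul_lie, lie_smul, lie_sub, mul_add 2 k 1, mul_one, h1, h2,
    ← Complex.coe_smul, elD, mul_add 2 k 1]
  push_cast
  simp only [two_mul (wordSum _ _ _ _)]
  match_scalars <;> ring

lemma lie_elU_elG {k : ℕ} (hk : k + 1 ≤ n - 1) :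
    ⁅elU n 0, elG n (k + 1)⁆ = (-4 : ℝ) • (elU n (k + 1) - elD n k) := by
  have h1 := (isChain_gen hn).lie_wordSum_even_same 1 hk
  have h2 := (isChain_gen hn).lie_wordSum_even_other 0 hk
  rw [(isChain_gen hn).wordSum_add_two 0] at h1
  rw [elD, elU, elG, smul_lie, lie_smul, lie_sub, mul_add 2 k 1, mul_one, h1, h2,
    ← Complex.coe_smul, elU, mul_add 2 k 1]
  push_cast
  simp only [two_mul (wordSum _ _ _ _)]
  match_scalars <;> ring

end Strings

/-- Makes the trace form definite on the dynamical Lie algebra, as needed in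
`lie_hatY_hatZ_ne_zero`. -/
lemma conjTranspose_eq_neg {n : ℕ} {u : Op n} (hu : u ∈ dynamicalLieAlgebra n) :
    u.conjTranspose = -u := by
  induction hu using LieSubalgebra.lieSpan_induction with
  | mem u hu =>
    rcases hu with rfl | rfl
    · rw [H0, Matrix.conjTranspose_smul, Matrix.conjTranspose_sum, Complex.star_def, Complex.conj_I,
        neg_smul]
      congr 2
      refine Finset.sum_congr rfl fun j _ => ?_
      rw [Matrix.conjTranspose_mul, conjTranspose_site conjTranspose_sigmaZ,
        conjTranspose_site conjTranspose_sigmaZ]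
      exact (commute_site_self _ _ _).eq
    · rw [H1, Matrix.conjTranspose_smul, Matrix.conjTranspose_sum, Complex.star_def, Complex.conj_I,
        neg_smul]
      congr 2
      exact Finset.sum_congr rfl fun j _ => conjTranspose_site conjTranspose_sigmaX j
  | zero => simp
  | add u v _ _ hu hv => rw [Matrix.conjTranspose_add, hu, hv, neg_add]
  | smul c u _ hu => rw [Matrix.conjTranspose_smul, hu, star_trivial, smul_neg]
  | lie u v _ _ hu hv =>
    simp only [Ring.lie_def, Matrix.conjTranspose_sub, Matrix.conjTranspose_mul, hu, hv]
    noncomm_ring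

lemma elU_mem (n : ℕ) [NeZero n] : elU n 0 ∈ dynamicalLieAlgebra n :=
  H0_eq (n := n) ▸ LieSubalgebra.subset_lieSpan (Set.mem_insert _ _)

lemma elD_mem (n : ℕ) [NeZero n] : elD n 0 ∈ dynamicalLieAlgebra n := by
  have h : Complex.I • H1 n ∈ dynamicalLieAlgebra n :=
    LieSubalgebra.subset_lieSpan (Set.mem_insert_of_mem _ rfl)
  rw [H1_eq] at h
  exact neg_mem_iff.1 h

/-! ### The ideal of a root -/

lemma span_hat_eq (n : ℕ) (x : ℝ) : Submodule.span ℝ {-hatY n x, hatX n x, hatZ n x}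
    = Submodule.span ℝ {hatX n x, hatY n x, hatZ n x} := by
  refine le_antisymm (Submodule.span_le.2 ?_) (Submodule.span_le.2 ?_) <;>
    rintro v (rfl | rfl | rfl) <;> rw [SetLike.mem_coe, Submodule.mem_span_triple]
  · exact ⟨0, -1, 0, by module⟩
  · exact ⟨1, 0, 0, by module⟩
  · exact ⟨0, 0, 1, by module⟩
  · exact ⟨0, 1, 0, by module⟩
  · exact ⟨-1, 0, 0, by module⟩
  · exact ⟨0, 0, 1, by module⟩

section Root

variable {n : ℕ} [NeZero n] (hn : 3 ≤ n)
include hn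

lemma hatY_eq (x : ℝ) :
    -hatY n x = ∑ k ∈ Finset.range (n - 1), (a k).eval x • (elU n k - elD n (k + 1)) := by
  rw [hatY, ← Finset.sum_neg_distrib]
  refine Finset.sum_congr rfl fun k hk => ?_
  rw [Finset.mem_range] at hk
  rw [bY_eq (by omega) (by omega), bZ_eq (by omega) (by omega)]
  module

lemma hatZ_eq (x : ℝ) :
    hatZ n x = ∑ k ∈ Finset.range (n - 1), (a k).eval x • elG n (k + 1) := by
  refine Finset.sum_congr rfl fun k hk => ?_
  rw [Finset.mem_range] at hk
  rw [bYZ_eq (by omega) (by omega)]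

/-- The separate first and last terms of `X̂` are the ends `k = 0` and `k = n - 2` of a uniform sum,
since `𝐗 = -D_0` and `𝐗𝐗 = U_{n-1}`. -/
lemma hatX_eq (x : ℝ) :
    hatX n x = ∑ k ∈ Finset.range (n - 1), (a k).eval x • (elU n (k + 1) - elD n k) := by
  obtain ⟨m, rfl⟩ : ∃ m, n = m + 3 := ⟨n - 3, by omega⟩
  have h1 : ∑ k ∈ Finset.Icc 1 m, (a k).eval x • (bZ (m + 3) (k + 1) - bY (m + 3) (k - 1))
      = ∑ k ∈ Finset.range m,
        (a (k + 1)).eval x • (elU (m + 3) (k + 1 + 1) - elD (m + 3) (k + 1)) := by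
    rw [show Finset.Icc 1 m = Finset.Ico 1 (m + 1) from rfl, Finset.sum_Ico_eq_sum_range,
      Nat.add_sub_cancel]
    refine Finset.sum_congr rfl fun k hk => ?_
    rw [Finset.mem_range] at hk
    rw [add_comm 1 k, Nat.add_sub_cancel, bZ_eq (by omega) (by omega), bY_eq (by omega) (by omega)]
  have h2 : bY (m + 3) m = elD (m + 3) (m + 1) := bY_eq (by omega) (by omega)
  have h3 : bZ (m + 3) 1 = elU (m + 3) 1 := bZ_eq (by omega) (by omega)
  have h4 : bXX (m + 3) = elU (m + 3) (m + 2) := bXX_eq (by omega)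
  rw [hatX, show m + 3 - 3 = m from rfl, show m + 3 - 2 = m + 1 from rfl,
    show m + 3 - 1 = m + 1 + 1 from rfl, h1, h2, h3, h4, bX_eq (by omega), Finset.sum_range_succ,
    Finset.sum_range_succ']
  module

/-- Among the strings in `Ŷ` only `𝐙^0` is diagonal. The nonzero entry shows `Ŷ ≠ 0`, whence `Ẑ ≠
0`. -/
lemma hatY_apply_zero (x : ℝ) : hatY n x 0 0 = -(Complex.I * n) := by
  -- Translations fix the constant word `0`, so each of the `n` conjugates has the same entry there.
  have hsym : ∀ A : Op n, symmetrize A 0 0 = n * A 0 0 := fun A => by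
    rw [symmetrize, Matrix.sum_apply, Finset.sum_congr rfl fun k _ => ?_, Finset.sum_const,
      Finset.card_range, nsmul_eq_mul]
    rw [translation, Matrix.transpose_permMatrix, Equiv.Perm.permMatrix, Equiv.Perm.permMatrix,
      PEquiv.toMatrix_toPEquiv_mul, PEquiv.mul_toMatrix_toPEquiv]
    rfl
  have hY : ∀ k, bY n k 0 0 = 0 := fun k => by
    rw [bY, Matrix.smul_apply, hsym, pauliString, tensor, Matrix.of_apply,
      Finset.prod_eq_zero (Finset.mem_univ (0 : Fin n)) (by simp [sigmaY])]
    simp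
  have hZ : ∀ k < n - 1, bZ n k 0 0 = if k = 0 then Complex.I * n else 0 := fun k hk => by
    rw [bZ, Matrix.smul_apply, hsym, pauliString, tensor, Matrix.of_apply]
    split_ifs with h
    · rw [Finset.prod_eq_one fun j _ => ?_]
      · simp
      · subst h
        split_ifs <;> first | omega | simp [sigmaZ]
    · rw [Finset.prod_eq_zero (Finset.mem_univ (⟨1, by omega⟩ : Fin n))]
      · simp
      · rw [if_neg (by simp), if_pos (by simp; omega)]
        simp [sigmaX]
  rw [hatY, Matrix.sum_apply, Finset.sum_eq_single_of_mem 0 (by simp; omega)]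
  · simp [hY, hZ 0 (by omega), a]
  · intro k hk hk0
    rw [Finset.mem_range] at hk
    simp [hY, hZ k hk, hk0]

lemma isRootTriple {x : ℝ} (hx : (a (n - 1)).IsRoot x) :
    IsRootTriple (elD n 0) (elU n 0) x (-hatY n x) (hatX n x) (hatZ n x) := by
  have hP := hatY_eq hn x
  have hQ := hatX_eq hn x
  have hZ := hatZ_eq hn x
  have hn2 : 2 ≤ n := by omega
  have hsum := sum_a_smul_add (elG n) x (n - 2)
  rw [show n - 2 + 1 = n - 1 by omega, show n - 2 + 2 = n by omega, elG_zero, elG_last hn2,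
    hx.eq_zero, ← hZ, smul_zero, zero_smul, add_zero, add_zero, sub_zero] at hsum
  have h1 : ⁅elD n 0, -hatY n x⁆ = (4 : ℝ) • hatZ n x := by
    rw [hP, hZ, lie_sum, Finset.smul_sum]
    refine Finset.sum_congr rfl fun k hk => ?_
    rw [Finset.mem_range] at hk
    rw [lie_smul, lie_sub, lie_elD_elU hn2 (by omega), lie_elD_elD hn2 (by omega)]
    module
  have h2 : ⁅elD n 0, hatX n x⁆ = (2 * x) • hatZ n x := by
    rw [hQ, lie_sum, mul_smul, ← hsum, Finset.smul_sum]
    refine Finset.sum_congr rfl fun k hk => ?_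
    rw [Finset.mem_range] at hk
    rw [lie_smul, lie_sub, lie_elD_elU hn2 (by omega), lie_elD_elD hn2 (by omega)]
    module
  have h3 : ⁅elD n 0, hatZ n x⁆ = (-4 : ℝ) • -hatY n x := by
    rw [hP, hZ, lie_sum, Finset.smul_sum]
    refine Finset.sum_congr rfl fun k hk => ?_
    rw [Finset.mem_range] at hk
    rw [lie_smul, lie_elD_elG hn2 (by omega)]
    module
  have h4 : ⁅elU n 0, -hatY n x⁆ = (2 * x) • hatZ n x := by
    rw [hP, lie_sum, mul_smul, ← hsum, Finset.smul_sum]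
    refine Finset.sum_congr rfl fun k hk => ?_
    rw [Finset.mem_range] at hk
    rw [lie_smul, lie_sub, lie_elU_elU hn2 (by omega), lie_elU_elD hn2 (by omega)]
    module
  have h5 : ⁅elU n 0, hatX n x⁆ = (4 : ℝ) • hatZ n x := by
    rw [hQ, hZ, lie_sum, Finset.smul_sum]
    refine Finset.sum_congr rfl fun k hk => ?_
    rw [Finset.mem_range] at hk
    rw [lie_smul, lie_sub, lie_elU_elU hn2 (by omega), lie_elU_elD hn2 (by omega)]
    module
  have h6 : ⁅elU n 0, hatZ n x⁆ = (-4 : ℝ) • hatX n x := by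
    rw [hQ, hZ, lie_sum, Finset.smul_sum]
    refine Finset.sum_congr rfl fun k hk => ?_
    rw [Finset.mem_range] at hk
    rw [lie_smul, lie_elU_elG hn2 (by omega)]
    module
  refine ⟨?_, fun h0 => ?_, h1, h2, h3, h4, h5, h6⟩
  · have := abs_lt.1 (abs_lt_two_of_isRoot_a hx)
    nlinarith
  · rw [h0, lie_zero, eq_comm, smul_neg, neg_smul, neg_neg] at h3
    have h7 := congr_fun (congr_fun h3 0) 0
    rw [Matrix.smul_apply, hatY_apply_zero hn] at h7
    simp at h7
    omega

/-! ### The dynamical Lie algebra -/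

lemma elG_mem {k : ℕ} (hk : k ≤ n - 1) (h : elU n k ∈ dynamicalLieAlgebra n) :
    elG n (k + 1) ∈ dynamicalLieAlgebra n := by
  have h1 := (dynamicalLieAlgebra n).smul_mem (1 / 2 : ℝ)
    ((dynamicalLieAlgebra n).lie_mem (elD_mem n) h)
  rw [lie_elD_elU (by omega) hk, smul_smul] at h1
  norm_num at h1
  exact h1

/-- The Onsager relations climb a ladder: `U_k` gives `G_{k+1}`, whose brackets with the generators
give `U_{k+1}` and `D_{k+1}` modulo `D_k` and `U_k`. -/
lemma el_mem (k : ℕ) (hk : k ≤ n - 1) :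
    elU n k ∈ dynamicalLieAlgebra n ∧ elD n k ∈ dynamicalLieAlgebra n := by
  induction k with
  | zero => exact ⟨elU_mem n, elD_mem n⟩
  | succ k ih =>
    obtain ⟨hU, hD⟩ := ih (by omega)
    have hG := elG_mem hn (by omega) hU
    have h1 := (dynamicalLieAlgebra n).lie_mem (elU_mem n) hG
    have h2 := (dynamicalLieAlgebra n).lie_mem (elD_mem n) hG
    rw [lie_elU_elG (by omega) hk] at h1
    rw [lie_elD_elG (by omega) hk] at h2
    constructor
    · have := add_mem ((dynamicalLieAlgebra n).smul_mem (-1 / 4 : ℝ) h1) hD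
      rwa [smul_smul, show (-1 / 4 : ℝ) * -4 = 1 by norm_num, one_smul, sub_add_cancel] at this
    · have := add_mem ((dynamicalLieAlgebra n).smul_mem (1 / 4 : ℝ) h2) hU
      rwa [smul_smul, show (1 / 4 : ℝ) * -4 = -1 by norm_num, neg_smul, one_smul, neg_sub,
        sub_add_cancel] at this

lemma span_le_dynamicalLieAlgebra (x : ℝ) :
    Submodule.span ℝ {-hatY n x, hatX n x, hatZ n x} ≤ (dynamicalLieAlgebra n).toSubmodule := by
  rw [Submodule.span_le]
  rintro v (rfl | rfl | rfl)
  · rw [hatY_eq hn]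
    refine Submodule.sum_mem _ fun k hk => Submodule.smul_mem _ _ ?_
    rw [Finset.mem_range] at hk
    exact sub_mem (el_mem hn k (by omega)).1 (el_mem hn (k + 1) (by omega)).2
  · rw [hatX_eq hn]
    refine Submodule.sum_mem _ fun k hk => Submodule.smul_mem _ _ ?_
    rw [Finset.mem_range] at hk
    exact sub_mem (el_mem hn (k + 1) (by omega)).1 (el_mem hn k (by omega)).2
  · rw [hatZ_eq hn]
    refine Submodule.sum_mem _ fun k hk => Submodule.smul_mem _ _ ?_
    rw [Finset.mem_range] at hk
    exact elG_mem hn (by omega) (el_mem hn k (by omega)).1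

lemma exists_lieIdeal_root {x : ℝ} (hx : (a (n - 1)).IsRoot x) :
    ∃ I : LieIdeal ℝ (dynamicalLieAlgebra n),
      I.toSubmodule.map (dynamicalLieAlgebra n).toSubmodule.subtype
        = Submodule.span ℝ {-hatY n x, hatX n x, hatZ n x} := by
  have h := isRootTriple hn hx
  refine exists_lieIdeal_lieSpan (span_le_dynamicalLieAlgebra hn x) ?_
  rintro u (rfl | rfl) v hv <;> obtain ⟨p, q, z, rfl⟩ := Submodule.mem_span_triple.1 hv <;>
    rw [Submodule.mem_span_triple]
  · rw [H0_eq, h.lie_comb']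
    exact ⟨0, -(4 * z), 2 * x * p + 4 * q, by module⟩
  · rw [H1_eq, neg_lie, h.lie_comb]
    exact ⟨4 * z, 0, -(4 * p + 2 * x * q), by module⟩

/-- Invariance of the trace form gives `4 tr(Z²) = tr([D_0, P] Z) = tr(D_0 [P, Z])`, and `tr(Z²) ≠
0` for a nonzero skew-Hermitian `Z`. -/
lemma lie_hatY_hatZ_ne_zero {x : ℝ} (hx : (a (n - 1)).IsRoot x) :
    ⁅-hatY n x, hatZ n x⁆ ≠ 0 := by
  intro h0
  have h := isRootTriple hn hx
  have hZ : hatZ n x ∈ dynamicalLieAlgebra n :=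
    span_le_dynamicalLieAlgebra hn x (Submodule.subset_span (by simp))
  have h1 : Matrix.trace (⁅elD n 0, -hatY n x⁆ * hatZ n x)
      = Matrix.trace (elD n 0 * ⁅-hatY n x, hatZ n x⁆) := by
    simp only [Ring.lie_def, sub_mul, mul_sub, Matrix.trace_sub]
    rw [mul_assoc, mul_assoc, Matrix.trace_mul_comm (-hatY n x), mul_assoc]
  rw [h0, mul_zero, Matrix.trace_zero, h.lie_P, Matrix.smul_mul, Matrix.trace_smul,
    smul_eq_zero_iff_right (by norm_num)] at h1
  have h2 : Matrix.trace (hatZ n x * (hatZ n x).conjTranspose) = 0 := by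
    rw [conjTranspose_eq_neg hZ, mul_neg, Matrix.trace_neg, h1, neg_zero]
  open ComplexOrder in
  exact h.ne_zero (Matrix.trace_mul_conjTranspose_self_eq_zero_iff.1 h2)

lemma lie_mem_span {x : ℝ} (hx : (a (n - 1)).IsRoot x) {u v : Op n}
    (hu : u ∈ dynamicalLieAlgebra n) (hv : v ∈ Submodule.span ℝ {-hatY n x, hatX n x, hatZ n x}) :
    ⁅u, v⁆ ∈ Submodule.span ℝ {-hatY n x, hatX n x, hatZ n x} := by
  obtain ⟨I, hI⟩ := exists_lieIdeal_root hn hx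
  rw [← hI] at hv ⊢
  obtain ⟨w, hw, rfl⟩ := hv
  exact ⟨⁅(⟨u, hu⟩ : dynamicalLieAlgebra n), w⁆, I.lie_mem hw, rfl⟩

lemma exists_isCyclicTriple_root {x : ℝ} (hx : (a (n - 1)).IsRoot x) :
    ∃ s : Fin 3 → Op n, IsCyclicTriple s ∧ LinearIndependent ℝ s ∧
      Submodule.span ℝ (Set.range s) = Submodule.span ℝ {-hatY n x, hatX n x, hatZ n x} := by
  have hL := span_le_dynamicalLieAlgebra hn x
  have hP : -hatY n x ∈ Submodule.span ℝ {-hatY n x, hatX n x, hatZ n x} :=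
    Submodule.subset_span (by simp)
  have hQ : hatX n x ∈ Submodule.span ℝ {-hatY n x, hatX n x, hatZ n x} :=
    Submodule.subset_span (by simp)
  have hZ : hatZ n x ∈ Submodule.span ℝ {-hatY n x, hatX n x, hatZ n x} :=
    Submodule.subset_span (by simp)
  exact (isRootTriple hn hx).exists_isCyclicTriple (lie_mem_span hn hx (hL hP) hZ)
    (lie_mem_span hn hx (hL hQ) hZ) (lie_hatY_hatZ_ne_zero hn hx)

omit [NeZero n] in
lemma opNorm_ne_zero {A : Op n} (hA : A ≠ 0) : opNorm A ≠ 0 := by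
  open ComplexOrder in
  have h1 := (Matrix.posSemidef_self_mul_conjTranspose A).trace_nonneg
  open ComplexOrder in
  have h2 := mt Matrix.trace_mul_conjTranspose_self_eq_zero_iff.1 hA
  rw [Complex.nonneg_iff] at h1
  have h3 : 0 < (A * A.conjTranspose).trace.re :=
    lt_of_le_of_ne h1.1 fun h => h2 (Complex.ext h.symm h1.2.symm)
  have h4 : (0 : ℝ) < n := by exact_mod_cast (by omega : 0 < n)
  exact (Real.sqrt_pos.2 (by positivity)).ne'

/-- Linear independence of the root triple makes `S̃_x` and `S̃_y` nonzero, and `x < 2`, so all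
normalizing factors are finite and nonzero. -/
lemma span_S_eq {x : ℝ} (hx : (a (n - 1)).IsRoot x) :
    Submodule.span ℝ {Sx n x, Sy n x, Sz n x}
      = Submodule.span ℝ {hatX n x, hatY n x, hatZ n x} := by
  have h := isRootTriple hn hx
  have h1 : opNorm (tildeSx n x) ≠ 0 := opNorm_ne_zero hn fun h0 => by
    have := (h.eq_zero_of_comb_eq_zero (p := -1) (q := 1) (z := 0)
      (by rw [← h0, tildeSx]; module)).1
    norm_num at this
  have h2 : opNorm (tildeSy n x) ≠ 0 := opNorm_ne_zero hn fun h0 => by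
    have := (h.eq_zero_of_comb_eq_zero (p := 1) (q := 1) (z := 0)
      (by rw [← h0, tildeSy]; module)).1
    norm_num at this
  have h3 : √(2 - x) ≠ 0 := (Real.sqrt_pos.2
    (by linarith [(abs_lt.1 (abs_lt_two_of_isRoot_a hx)).2])).ne'
  exact span_add_sub_eq (neg_ne_zero.2 (by positivity)) (by positivity) (by positivity) _ _ _

end Root

/-! ### The Lie algebra `su 2` -/

/-- The elements `i σ / 2` of `su 2`, for the three Pauli matrices `σ`. -/
noncomputable def suTwoTriple : Fin 3 → su 2 :=
  ![⟨(Complex.I / 2) • sigmaX, by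
      constructor
      · ext i j; fin_cases i <;> fin_cases j <;> simp [sigmaX]; all_goals ring
      · simp [sigmaX, Matrix.trace_fin_two]⟩,
    ⟨(Complex.I / 2) • sigmaY, by
      constructor
      · ext i j; fin_cases i <;> fin_cases j <;> simp [sigmaY]; all_goals ring
      · simp [sigmaY, Matrix.trace_fin_two]⟩,
    ⟨(Complex.I / 2) • sigmaZ, by
      constructor
      · ext i j; fin_cases i <;> fin_cases j <;> simp [sigmaZ]; all_goals ring
      · simp [sigmaZ, Matrix.trace_fin_two]⟩]

lemma isCyclicTriple_suTwoTriple : IsCyclicTriple suTwoTriple := by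
  have hI := Complex.I_mul_I
  constructor <;> apply Subtype.ext <;> rw [LieSubalgebra.coe_bracket, Ring.lie_def] <;>
    simp only [suTwoTriple, Matrix.cons_val] <;> ext i j <;> fin_cases i <;> fin_cases j <;>
    simp [sigmaX, sigmaY, sigmaZ] <;> grind

lemma exists_basis_suTwo : ∃ b : Module.Basis (Fin 3) ℝ (su 2), IsCyclicTriple b := by
  have hval : ∀ g : Fin 3 → ℝ, ((∑ i, g i • suTwoTriple i : su 2) : Matrix (Fin 2) (Fin 2) ℂ)
      = !![⟨0, g 2 / 2⟩, ⟨-g 1 / 2, g 0 / 2⟩; ⟨g 1 / 2, g 0 / 2⟩, ⟨0, -g 2 / 2⟩] := fun g => by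
    rw [Fin.sum_univ_three]
    ext i j
    fin_cases i <;> fin_cases j <;>
      simp [suTwoTriple, sigmaX, sigmaY, sigmaZ, Complex.ext_iff] <;> ring_nf <;> simp
  have hli : LinearIndependent ℝ suTwoTriple := by
    rw [Fintype.linearIndependent_iff]
    intro g hg
    have h1 := hval g
    rw [hg] at h1
    have h00 := congr_fun (congr_fun h1 0) 0
    have h01 := congr_fun (congr_fun h1 0) 1
    simp [Complex.ext_iff] at h00 h01
    intro i
    fin_cases i <;> grind
  have hspan : ⊤ ≤ Submodule.span ℝ (Set.range suTwoTriple) := by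
    rintro ⟨A, hA, hA'⟩ -
    rw [Submodule.mem_span_range_iff_exists_fun]
    refine ⟨![2 * (A 0 1).im, -2 * (A 0 1).re, 2 * (A 0 0).im], Subtype.ext ?_⟩
    rw [hval]
    have h00 := congr_fun (congr_fun hA 0) 0
    have h01 := congr_fun (congr_fun hA 0) 1
    rw [Matrix.trace_fin_two] at hA'
    simp [Complex.ext_iff] at h00 h01 hA'
    ext i j
    fin_cases i <;> fin_cases j <;> simp [Complex.ext_iff] <;> grind
  refine ⟨Module.Basis.mk hli hspan, ?_⟩
  rw [Module.Basis.coe_mk]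
  exact isCyclicTriple_suTwoTriple

lemma exists_lieIdeal_isSimple {n : ℕ} (hn : 3 ≤ n) {x : ℝ} (hx : (a (n - 1)).IsRoot x) :
    ∃ I : LieIdeal ℝ (dynamicalLieAlgebra n),
      I.toSubmodule.map (dynamicalLieAlgebra n).toSubmodule.subtype
        = Submodule.span ℝ {hatX n x, hatY n x, hatZ n x} ∧
      LieAlgebra.IsSimple ℝ I ∧ Nonempty (I ≃ₗ⁅ℝ⁆ su 2) := by
  have : NeZero n := ⟨by omega⟩
  obtain ⟨I, hI⟩ := exists_lieIdeal_root hn hx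
  obtain ⟨s, hs, hli, hspan⟩ := exists_isCyclicTriple_root hn hx
  obtain ⟨b, hb⟩ := exists_basis_isCyclicTriple hs hli (hI.trans hspan.symm)
  obtain ⟨c, hc⟩ := exists_basis_suTwo
  exact ⟨I, hI.trans (span_hat_eq n x), isSimple_of_isCyclicTriple b hb,
    nonempty_lieEquiv_of_isCyclicTriple b c hb hc⟩

end IsingChain

/-! ### The main theorem -/

theorem mainTheorem6 (n : ℕ) (hn : 3 ≤ n) :
    {x : ℝ | (IsingChain.a (n - 1)).IsRoot x}.ncard = n - 1 ∧
    (∀ x : ℝ, (IsingChain.a (n - 1)).IsRoot x ↔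
      Module.End.HasEigenvalue (Matrix.toLin' (IsingChain.tridiag (n - 1))) x) ∧
    (∀ x : ℝ, (IsingChain.a (n - 1)).IsRoot x → |x| < 2) ∧
    ∃ I : ℝ → LieIdeal ℝ (IsingChain.dynamicalLieAlgebra n),
      (∀ x : ℝ, (IsingChain.a (n - 1)).IsRoot x →
        (I x).toSubmodule.map (IsingChain.dynamicalLieAlgebra n).toSubmodule.subtype =
          Submodule.span ℝ {IsingChain.hatX n x, IsingChain.hatY n x, IsingChain.hatZ n x} ∧
        (I x).toSubmodule.map (IsingChain.dynamicalLieAlgebra n).toSubmodule.subtype =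
          Submodule.span ℝ {IsingChain.Sx n x, IsingChain.Sy n x, IsingChain.Sz n x} ∧
        LieAlgebra.IsSimple ℝ (I x) ∧
        Nonempty (I x ≃ₗ⁅ℝ⁆ IsingChain.su 2)) ∧
      (∀ x y : ℝ, (IsingChain.a (n - 1)).IsRoot x → (IsingChain.a (n - 1)).IsRoot y → x ≠ y →
        I x ≠ I y ∧ I x ⊓ I y = ⊥) ∧
      (I '' {x : ℝ | (IsingChain.a (n - 1)).IsRoot x}).ncard = n - 1 := by
  have : NeZero n := ⟨by omega⟩
  -- The family is indexed by all reals, with the irrelevant value `⊥` away from the roots.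
  have hex : ∀ x : ℝ, ∃ I : LieIdeal ℝ (IsingChain.dynamicalLieAlgebra n),
      (IsingChain.a (n - 1)).IsRoot x →
      I.toSubmodule.map (IsingChain.dynamicalLieAlgebra n).toSubmodule.subtype
        = Submodule.span ℝ {IsingChain.hatX n x, IsingChain.hatY n x, IsingChain.hatZ n x} ∧
      LieAlgebra.IsSimple ℝ I ∧ Nonempty (I ≃ₗ⁅ℝ⁆ IsingChain.su 2) := fun x => by
    by_cases hx : (IsingChain.a (n - 1)).IsRoot x
    · obtain ⟨I, hI⟩ := IsingChain.exists_lieIdeal_isSimple hn hx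
      exact ⟨I, fun _ => hI⟩
    · exact ⟨⊥, fun h => absurd h hx⟩
  choose I hI using hex
  have hle : ∀ x y : ℝ, (IsingChain.a (n - 1)).IsRoot x → (IsingChain.a (n - 1)).IsRoot y →
      x ≠ y → ¬ I x ≤ I y := fun x y hx hy hxy h => by
    refine (IsingChain.isRootTriple hn hx).notMem_span (IsingChain.isRootTriple hn hy) hxy ?_
    rw [IsingChain.span_hat_eq, ← (hI y hy).1]
    refine Submodule.map_mono ((LieSubmodule.toSubmodule_le_toSubmodule _ _).2 h) ?_
    rw [(hI x hx).1]
    exact Submodule.subset_span (by simp)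
  have hne : ∀ x y : ℝ, (IsingChain.a (n - 1)).IsRoot x → (IsingChain.a (n - 1)).IsRoot y →
      x ≠ y → I x ≠ I y := fun x y hx hy hxy h => hle x y hx hy hxy h.le
  refine ⟨IsingChain.ncard_roots_a _, IsingChain.isRoot_a_iff_hasEigenvalue (by omega),
    fun x hx => IsingChain.abs_lt_two_of_isRoot_a hx, I, fun x hx => ?_, fun x y hx hy hxy => ?_, ?_⟩
  · obtain ⟨h1, h2, h3⟩ := hI x hx
    exact ⟨h1, h1.trans (IsingChain.span_S_eq hn hx).symm, h2, h3⟩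
  · exact ⟨hne x y hx hy hxy,
      IsingChain.inf_eq_bot_of_isSimple (hI x hx).2.1 (hle x y hx hy hxy)⟩
  · rw [Set.InjOn.ncard_image, IsingChain.ncard_roots_a]
    exact fun x hx y hy h => by_contra fun hxy => hne x y hx hy hxy h
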